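/- Let $\mathcal{A}$ be a (not necessarily unital) $C^*$-algebra, let $\mathcal{M}\subseteq\mathcal{B}(\mathcal{H})$ be a von Neumann algebra on a complex Hilbert space $\mathcal{H}$ with commutant $\mathcal{M}'$, and let $\varphi:\mathcal{A}\to\mathcal{M}$ be a bounded representation, i.e. a bounded complex-linear multiplicative map (not assumed unital or $*$-preserving). Write $CP(\mathcal{A},\mathcal{M})$ for the set of completely positive linear maps $\mathcal{A}\to\mathcal{M}$, and let $\mathcal{A}\otimes_{\max}\mathcal{M}'$ be the completion of the algebraic tensor product $\mathcal{A}\odot\mathcal{M}'$ in its largest $C^*$-seminorm. Then the following are equivalent: 1. $\varphi$ is similar in $\mathcal{M}$ to a $*$-representation: there is an invertible $S\in\mathcal{M}$ such that $a\mapsto S\varphi(a)S^{-1}$ is a $*$-homomorphism $\mathcal{A}\to\mathcal{M}$. 2. The map $\Phi\bigl(\sum_{i=1}^n a_i\otimes x_i\bigr)=\sum_{i=1}^n\varphi(a_i)x_i$ ($a_i\in\mathcal{A}$, $x_i\in\mathcal{M}'$) extends to a completely bounded representation (multiplicative linear map) $\Phi:\mathcal{A}\otimes_{\max}\mathcal{M}'\to\mathcal{B}(\mathcal{H})$.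 3. $\varphi=\varphi_1-\varphi_2+i(\varphi_3-\varphi_4)$ for some $\varphi_1,\varphi_2,\varphi_3,\varphi_4\in CP(\mathcal{A},\mathcal{M})$. 4. There exist $\phi_1,\phi_2\in CP(\mathcal{A},\mathcal{M})$ such that $\Psi:\mathcal{A}\to M_2(\mathcal{M})$, $\Psi(a)=\begin{pmatrix}\phi_1(a)&\varphi(a^*)^*\\ \varphi(a)&\phi_2(a)\end{pmatrix}$, is completely positive. 5. There exist $\psi\in CP(\mathcal{A},\mathcal{M})$ and $T,S\in\mathcal{M}$ such that $\varphi(a)=T^*\psi(a)S$ for all $a\in\mathcal{A}$. 6. There exist finitely many $\psi_1,\dots,\psi_n\in CP(\mathcal{A},\mathcal{M})$ and $T_i,S_i\in\mathcal{M}$ such that $\varphi(a)=\sum_{i=1}^n T_i^*\psi_i(a)S_i$ for all $a\in\mathcal{A}$. 7. There exist finitely many $*$-representations ($*$-homomorphisms) $\pi_1,\dots,\pi_n:\mathcal{A}\to\mathcal{M}$, positive invertible operators $T_1,\dots,T_n\in\mathcal{M}$, and $\alpha_1,\dots,\alpha_n>0$ with $\sum_{i=1}^n\alpha_i=1$ such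 that $\varphi(a)=\sum_{i=1}^n\alpha_iT_i\pi_i(a)T_i^{-1}$ for all $a\in\mathcal{A}$. -/

import Mathlib

open scoped TensorProduct CStarAlgebra

noncomputable section

/-! ### C⋆-seminorms and the associated C⋆-algebra -/

/-- A C⋆-seminorm on a complex ⋆-algebra `D`: a submultiplicative seminorm satisfying the
C⋆-identity. -/
structure CStarSeminorm (D : Type*) [NonUnitalRing D] [StarRing D] [Module ℂ D] extends
    Seminorm ℂ D where
  mul_le' : ∀ x y : D, toFun (x * y) ≤ toFun x * toFun y
  star_mul_self' : ∀ x : D, toFun (star x * x) = toFun x * toFun x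

namespace CStarSeminorm

section Basic

variable {D : Type*} [NonUnitalRing D] [StarRing D] [Module ℂ D]

instance : CoeFun (CStarSeminorm D) fun _ => D → ℝ := ⟨fun p => p.toSeminorm⟩

theorem mul_le (p : CStarSeminorm D) (x y : D) : p (x * y) ≤ p x * p y := p.mul_le' x y

theorem star_mul_self (p : CStarSeminorm D) (x : D) : p (star x * x) = p x * p x :=
  p.star_mul_self' x

theorem nonneg (p : CStarSeminorm D) (x : D) : 0 ≤ p x := apply_nonneg p.toSeminorm x

theorem le_star (p : CStarSeminorm D) (x : D) : p x ≤ p (star x) := by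
  rcases (p.nonneg x).eq_or_lt with h | h
  · rw [← h]; exact p.nonneg _
  · have h1 := p.mul_le (star x) x
    rw [p.star_mul_self] at h1
    exact le_of_mul_le_mul_right h1 h

theorem map_star (p : CStarSeminorm D) (x : D) : p (star x) = p x := by
  refine le_antisymm ?_ (p.le_star x)
  simpa using p.le_star (star x)

/-- The zero C⋆-seminorm. -/
instance : Inhabited (CStarSeminorm D) :=
  ⟨{ (0 : Seminorm ℂ D) with
      mul_le' := fun _ _ => (mul_zero (0 : ℝ)).ge
      star_mul_self' := fun _ => (mul_zero (0 : ℝ)).symm }⟩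

/-- The algebra `D`, equipped with the topology of the C⋆-seminorm `p`. -/
def Pre (_p : CStarSeminorm D) : Type _ := D

variable (p : CStarSeminorm D)

instance : NonUnitalRing p.Pre := inferInstanceAs (NonUnitalRing D)
instance : StarRing p.Pre := inferInstanceAs (StarRing D)
instance : Module ℂ p.Pre := inferInstanceAs (Module ℂ D)

instance : SeminormedAddCommGroup p.Pre :=
  fast_instance%
    { AddGroupSeminorm.toSeminormedAddCommGroup (E := D) p.toSeminorm.toAddGroupSeminorm with
      toAddCommGroup := inferInstanceAs (AddCommGroup p.Pre) }

/-- The identity map from `D` to `p.Pre`. -/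
def toPre (x : D) : p.Pre := x

theorem norm_toPre (x : D) : ‖p.toPre x‖ = p x := rfl

instance : NormedSpace ℂ p.Pre where
  norm_smul_le c x := (map_smul_eq_mul p.toSeminorm c x).le

theorem Pre.norm_mul_le (x y : p.Pre) : ‖x * y‖ ≤ ‖x‖ * ‖y‖ := p.mul_le x y
theorem Pre.norm_star (x : p.Pre) : ‖star x‖ = ‖x‖ := p.map_star x
theorem Pre.norm_star_mul_self (x : p.Pre) : ‖star x * x‖ = ‖x‖ * ‖x‖ := p.star_mul_self x

/-- The Hausdorff completion of `D` with respect to the C⋆-seminorm `p`. -/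
def Compl : Type _ := UniformSpace.Completion p.Pre

instance : NormedAddCommGroup p.Compl :=
  inferInstanceAs (NormedAddCommGroup (UniformSpace.Completion p.Pre))
instance : NormedSpace ℂ p.Compl :=
  inferInstanceAs (NormedSpace ℂ (UniformSpace.Completion p.Pre))
instance : CompleteSpace p.Compl :=
  inferInstanceAs (CompleteSpace (UniformSpace.Completion p.Pre))

/-- The canonical map of `D` into its completion. -/
def incl (x : D) : p.Compl := UniformSpace.Completion.coe' (p.toPre x)

theorem norm_incl (x : D) : ‖p.incl x‖ = p x := UniformSpace.Completion.norm_coe (E := p.Pre) x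

theorem incl_add (x y : D) : p.incl (x + y) = p.incl x + p.incl y :=
  UniformSpace.Completion.coe_add (α := p.Pre) x y

theorem incl_smul (c : ℂ) (x : D) : p.incl (c • x) = c • p.incl x :=
  UniformSpace.Completion.coe_smul (X := p.Pre) c x

theorem denseRange_incl : DenseRange p.incl :=
  UniformSpace.Completion.denseRange_coe (α := p.Pre)

/-- The involution of the completion, extending that of `D` by continuity. -/
instance : Star p.Compl :=
  ⟨UniformSpace.Completion.map (α := p.Pre) (β := p.Pre) star⟩

theorem uniformContinuous_star_pre : UniformContinuous (star : p.Pre → p.Pre) := by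
  refine AddMonoidHomClass.uniformContinuous_of_bound
    (starAddEquiv (R := p.Pre)).toAddMonoidHom 1 fun x => ?_
  rw [one_mul]
  exact (Pre.norm_star p x).le

theorem continuous_star_compl : Continuous (star : p.Compl → p.Compl) :=
  UniformSpace.Completion.continuous_map

theorem star_incl (x : D) : star (p.incl x) = p.incl (star x) :=
  UniformSpace.Completion.map_coe (α := p.Pre) (β := p.Pre) (uniformContinuous_star_pre p) x

@[elab_as_elim]
theorem compl_ind {P : p.Compl → Prop} (hP : IsClosed {x | P x}) (h : ∀ x, P (p.incl x))
    (x : p.Compl) : P x :=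
  (denseRange_incl p).induction_on x hP h

end Basic

section Mul

variable {D : Type*} [NonUnitalRing D] [StarRing D] [Module ℂ D]
  [IsScalarTower ℂ D D] [SMulCommClass ℂ D D] (p : CStarSeminorm D)

instance : IsScalarTower ℂ p.Pre p.Pre := inferInstanceAs (IsScalarTower ℂ D D)
instance : SMulCommClass ℂ p.Pre p.Pre := inferInstanceAs (SMulCommClass ℂ D D)

/-- The product of `D` as a bounded bilinear map with values in the completion. -/
def preMulL : p.Pre →L[ℂ] p.Pre →L[ℂ] UniformSpace.Completion p.Pre :=
  LinearMap.mkContinuous₂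
    ((LinearMap.mul ℂ p.Pre).compr₂
      (UniformSpace.Completion.toComplL (𝕜 := ℂ) (E := p.Pre)).toLinearMap) 1 fun x y => by
    have h : ‖((x * y : p.Pre) : UniformSpace.Completion p.Pre)‖ ≤ ‖x‖ * ‖y‖ := by
      rw [UniformSpace.Completion.norm_coe]; exact Pre.norm_mul_le p x y
    simpa using h

/-- The product of the completion, extending that of `D` by continuity. -/
def mulL : p.Compl →L[ℂ] p.Compl →L[ℂ] p.Compl :=
  (ContinuousLinearMap.fromCompletion
    (ContinuousLinearMap.fromCompletion (preMulL p)).flip).flip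

instance : Mul p.Compl := ⟨fun x y => mulL p x y⟩

theorem compl_mul_def (x y : p.Compl) : x * y = mulL p x y := rfl

theorem incl_mul (x y : D) : p.incl (x * y) = p.incl x * p.incl y := by
  have h1 : mulL p (p.incl x) (p.incl y) =
      ContinuousLinearMap.fromCompletion (preMulL p) (p.incl x) (p.toPre y) :=
    congrArg (fun f : p.Compl →L[ℂ] p.Compl => f (p.incl x))
      (ContinuousLinearMap.fromCompletion_apply_coe
        (ContinuousLinearMap.fromCompletion (preMulL p)).flip (p.toPre y))
  have h2 : ContinuousLinearMap.fromCompletion (preMulL p) (p.incl x) = preMulL p (p.toPre x) :=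
    ContinuousLinearMap.fromCompletion_apply_coe (preMulL p) (p.toPre x)
  rw [compl_mul_def, h1, h2]
  rfl

theorem continuous_mul_compl : Continuous fun z : p.Compl × p.Compl => z.1 * z.2 :=
  (mulL p).continuous₂

instance : ContinuousMul p.Compl := ⟨continuous_mul_compl p⟩
instance : ContinuousStar p.Compl := ⟨continuous_star_compl p⟩

instance : NonUnitalRing p.Compl where
  toAddCommGroup := inferInstance
  left_distrib x y z := map_add (mulL p x) y z
  right_distrib x y z := by simp [compl_mul_def]
  zero_mul x := by simp [compl_mul_def]
  mul_zero x := map_zero (mulL p x)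
  mul_assoc x y z := by
    refine compl_ind p (isClosed_eq (by fun_prop) (by fun_prop)) (fun x => ?_) x
    refine compl_ind p (isClosed_eq (by fun_prop) (by fun_prop)) (fun y => ?_) y
    refine compl_ind p (isClosed_eq (by fun_prop) (by fun_prop)) (fun z => ?_) z
    simp only [← incl_mul, mul_assoc]

instance : NonUnitalNormedRing p.Compl where
  __ : NonUnitalRing p.Compl := inferInstance
  __ : NormedAddCommGroup p.Compl := inferInstance
  norm_mul_le x y := by
    refine compl_ind p (isClosed_le (by fun_prop) (by fun_prop)) (fun x => ?_) x
    refine compl_ind p (isClosed_le (by fun_prop) (by fun_prop)) (fun y => ?_) y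
    rw [← incl_mul, norm_incl, norm_incl, norm_incl]
    exact p.mul_le x y

instance : StarRing p.Compl where
  star_involutive x := by
    refine compl_ind p (isClosed_eq (by fun_prop) (by fun_prop)) (fun x => ?_) x
    rw [star_incl, star_incl, star_star]
  star_mul x y := by
    refine compl_ind p (isClosed_eq (by fun_prop) (by fun_prop)) (fun x => ?_) x
    refine compl_ind p (isClosed_eq (by fun_prop) (by fun_prop)) (fun y => ?_) y
    rw [← incl_mul, star_incl, star_incl, star_incl, ← incl_mul, star_mul]
  star_add x y := by
    refine compl_ind p (isClosed_eq (by fun_prop) (by fun_prop)) (fun x => ?_) x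
    refine compl_ind p (isClosed_eq (by fun_prop) (by fun_prop)) (fun y => ?_) y
    rw [← incl_add, star_incl, star_incl, star_incl, ← incl_add, star_add]

instance : CStarRing p.Compl where
  norm_mul_self_le x := by
    refine compl_ind p (isClosed_le (by fun_prop) (by fun_prop)) (fun x => ?_) x
    rw [star_incl, ← incl_mul, norm_incl, norm_incl, p.star_mul_self]

instance : IsScalarTower ℂ p.Compl p.Compl where
  smul_assoc c x y := by simp [compl_mul_def]

instance : SMulCommClass ℂ p.Compl p.Compl where
  smul_comm c x y := by simp [compl_mul_def]

instance [StarModule ℂ D] : StarModule ℂ p.Compl where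
  star_smul c x := by
    have h1 : Continuous fun x : p.Compl => star (c • x) := (continuous_const_smul c).star
    have h2 : Continuous fun x : p.Compl => star c • star x :=
      (continuous_star_compl p).const_smul (star c)
    refine compl_ind p (isClosed_eq h1 h2) (fun x => ?_) x
    rw [← incl_smul, star_incl, star_incl, ← incl_smul, star_smul]

/-- The Hausdorff completion of a ⋆-algebra with respect to a C⋆-seminorm is a C⋆-algebra. -/
instance [StarModule ℂ D] : NonUnitalCStarAlgebra p.Compl where

/-- The canonical order of the C⋆-algebra `p.Compl`. -/
instance [StarModule ℂ D] : PartialOrder p.Compl := CStarAlgebra.spectralOrder _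
instance [StarModule ℂ D] : StarOrderedRing p.Compl := CStarAlgebra.spectralOrderedRing _

end Mul

/-! ### The maximal tensor product -/

section Tensor

variable {A B : Type*} [NonUnitalCStarAlgebra A] [NonUnitalCStarAlgebra B]

/-- `‖a⋆a‖ a⋆a - (a⋆a)²` is of the form `c⋆c`. -/
theorem exists_star_mul_self_add (a : A) :
    ∃ c : A, ((‖a‖ ^ 2 : ℝ) : ℂ) • (star a * a) = star c * c + (star a * a) * (star a * a) := by
  let := CStarAlgebra.spectralOrder A
  have := CStarAlgebra.spectralOrderedRing A
  have h := CStarAlgebra.star_left_conjugate_le_norm_smul (a := a) (b := a * star a)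
    (IsSelfAdjoint.mul_star_self a)
  rw [← sub_nonneg, CStarAlgebra.nonneg_iff_eq_star_mul_self] at h
  obtain ⟨c, hc⟩ := h
  refine ⟨c, ?_⟩
  rw [← hc, CStarRing.norm_self_mul_star, ← sq]
  rw [Complex.coe_smul]
  simp [mul_assoc]

/-- Every C⋆-seminorm on the algebraic tensor product of two C⋆-algebras is a subcross
seminorm. -/
theorem apply_tmul_le (p : CStarSeminorm (A ⊗[ℂ] B)) (a : A) (b : B) :
    p (a ⊗ₜ b) ≤ ‖a‖ * ‖b‖ := by
  obtain ⟨c, hc⟩ := exists_star_mul_self_add a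
  obtain ⟨d, hd⟩ := exists_star_mul_self_add b
  set h := star a * a with hh
  set k := star b * b with hk
  have pos : ∀ (x : A) (y : B), 0 ≤ p.incl ((star x * x) ⊗ₜ[ℂ] (star y * y)) := by
    intro x y
    have : (star x * x) ⊗ₜ[ℂ] (star y * y) = star (x ⊗ₜ[ℂ] y) * (x ⊗ₜ[ℂ] y) := by simp
    rw [this, incl_mul, ← star_incl]
    exact star_mul_self_nonneg _
  have hsa : star h = h := by simp [hh]
  have ksa : star k = k := by simp [hk]
  have key : p.incl ((h * h) ⊗ₜ[ℂ] (k * k)) ≤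
      p.incl ((((‖a‖ ^ 2 : ℝ) : ℂ) • h) ⊗ₜ[ℂ] (((‖b‖ ^ 2 : ℝ) : ℂ) • k)) := by
    rw [hc, hd, TensorProduct.add_tmul, TensorProduct.tmul_add, TensorProduct.tmul_add]
    simp only [incl_add]
    have h1 := pos c d
    have h2 := pos c k
    have h3 := pos h d
    rw [ksa] at h2
    rw [hsa] at h3
    rw [← add_assoc]
    exact le_add_of_nonneg_left (add_nonneg (add_nonneg h1 h2) h3)
  have h0 : 0 ≤ p.incl ((h * h) ⊗ₜ[ℂ] (k * k)) := by
    have := pos h k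
    rwa [hsa, ksa] at this
  have hn := CStarAlgebra.norm_le_norm_of_nonneg_of_le h0 key
  have e1 : (h * h) ⊗ₜ[ℂ] (k * k) = star (h ⊗ₜ[ℂ] k) * (h ⊗ₜ[ℂ] k) := by simp [hsa, ksa]
  have e2 : p (h ⊗ₜ[ℂ] k) = p (a ⊗ₜ b) * p (a ⊗ₜ b) := by
    rw [← p.star_mul_self]; simp [hh, hk]
  rw [e1, norm_incl, p.star_mul_self, TensorProduct.smul_tmul_smul, incl_smul, norm_smul,
    norm_incl, e2] at hn
  have e3 : ‖((‖a‖ ^ 2 : ℝ) : ℂ) * ((‖b‖ ^ 2 : ℝ) : ℂ)‖ = (‖a‖ * ‖b‖) ^ 2 := by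
    rw [norm_mul, Complex.norm_real, Complex.norm_real]
    simp [mul_pow]
  rw [e3] at hn
  have h4 := p.nonneg (a ⊗ₜ b)
  by_contra! hlt
  have h5 : 0 ≤ ‖a‖ * ‖b‖ := by positivity
  have h6 : 0 < p (a ⊗ₜ b) := h5.trans_lt hlt
  have h7 : 0 < p (a ⊗ₜ b) * p (a ⊗ₜ b) := mul_pos h6 h6
  have h8 := le_of_mul_le_mul_right hn h7
  nlinarith

theorem bddAbove (x : A ⊗[ℂ] B) :
    BddAbove (Set.range fun p : CStarSeminorm (A ⊗[ℂ] B) => p x) := by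
  suffices ∃ C : ℝ, ∀ p : CStarSeminorm (A ⊗[ℂ] B), p x ≤ C by
    obtain ⟨C, hC⟩ := this
    exact ⟨C, by rintro _ ⟨p, rfl⟩; exact hC p⟩
  induction x using TensorProduct.induction_on with
  | zero => exact ⟨0, fun p => (map_zero p.toSeminorm).le⟩
  | tmul a b => exact ⟨_, fun p => apply_tmul_le p a b⟩
  | add x y hx hy =>
    obtain ⟨C, hC⟩ := hx
    obtain ⟨C', hC'⟩ := hy
    exact ⟨C + C', fun p => (map_add_le_add p.toSeminorm x y).trans (add_le_add (hC p) (hC' p))⟩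

theorem le_iSup (p : CStarSeminorm (A ⊗[ℂ] B)) (x : A ⊗[ℂ] B) :
    p x ≤ ⨆ q : CStarSeminorm (A ⊗[ℂ] B), q x :=
  le_ciSup (f := fun q : CStarSeminorm (A ⊗[ℂ] B) => q x) (bddAbove x) p

variable (A B) in
/-- The maximal C⋆-norm on the algebraic tensor product of two C⋆-algebras: the supremum of all
C⋆-seminorms. -/
def maxTensor : CStarSeminorm (A ⊗[ℂ] B) where
  toFun x := ⨆ p : CStarSeminorm (A ⊗[ℂ] B), p x
  map_zero' := by simp
  add_le' x y := ciSup_le fun p =>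
    (map_add_le_add p.toSeminorm x y).trans (add_le_add (le_iSup p x) (le_iSup p y))
  neg' x := by simp
  smul' c x := by
    simp only [map_smul_eq_mul]
    exact (Real.mul_iSup_of_nonneg (norm_nonneg c) _).symm
  mul_le' x y := ciSup_le fun p =>
    (p.mul_le x y).trans (mul_le_mul (le_iSup p x) (le_iSup p y) (p.nonneg y)
      ((p.nonneg x).trans (le_iSup p x)))
  star_mul_self' x := by
    apply le_antisymm
    · exact ciSup_le fun p => (p.star_mul_self x).le.trans
        (mul_self_le_mul_self (p.nonneg x) (le_iSup p x))
    · have h0 : 0 ≤ ⨆ p : CStarSeminorm (A ⊗[ℂ] B), p (star x * x) :=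
        Real.iSup_nonneg fun p => p.nonneg _
      rw [← Real.mul_self_sqrt h0]
      refine mul_self_le_mul_self (Real.iSup_nonneg fun p => p.nonneg x) (ciSup_le fun p => ?_)
      apply Real.le_sqrt_of_sq_le
      rw [sq, ← p.star_mul_self]
      exact le_iSup p _

theorem le_maxTensor (p : CStarSeminorm (A ⊗[ℂ] B)) (x : A ⊗[ℂ] B) : p x ≤ maxTensor A B x :=
  le_iSup p x

end Tensor

end CStarSeminorm

/-- The maximal C⋆-tensor product `A ⊗_max B`: the completion of the algebraic tensor product
in the maximal C⋆-norm. -/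
def MaxTensorProduct (A B : Type*) [NonUnitalCStarAlgebra A] [NonUnitalCStarAlgebra B] : Type _ :=
  (CStarSeminorm.maxTensor A B).Compl

namespace MaxTensorProduct

variable {A B : Type*} [NonUnitalCStarAlgebra A] [NonUnitalCStarAlgebra B]

instance : NonUnitalCStarAlgebra (MaxTensorProduct A B) :=
  inferInstanceAs (NonUnitalCStarAlgebra (CStarSeminorm.maxTensor A B).Compl)

/-- The canonical order of the C⋆-algebra `A ⊗_max B`. -/
instance : PartialOrder (MaxTensorProduct A B) := CStarAlgebra.spectralOrder _
instance : StarOrderedRing (MaxTensorProduct A B) := CStarAlgebra.spectralOrderedRing _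

/-- The canonical ⋆-homomorphism of the algebraic tensor product into `A ⊗_max B`. -/
def of : A ⊗[ℂ] B →⋆ₙₐ[ℂ] MaxTensorProduct A B where
  toFun := (CStarSeminorm.maxTensor A B).incl
  map_smul' := CStarSeminorm.incl_smul _
  map_zero' := UniformSpace.Completion.coe_zero (α := (CStarSeminorm.maxTensor A B).Pre)
  map_add' := CStarSeminorm.incl_add _
  map_mul' := CStarSeminorm.incl_mul _
  map_star' x := (CStarSeminorm.star_incl _ x).symm

theorem norm_of (x : A ⊗[ℂ] B) : ‖of x‖ = CStarSeminorm.maxTensor A B x :=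
  CStarSeminorm.norm_incl _ x

theorem denseRange_of : DenseRange (of : A ⊗[ℂ] B → MaxTensorProduct A B) :=
  CStarSeminorm.denseRange_incl _

/-- The elementary tensor `a ⊗ b` in `A ⊗_max B`. -/
def tmul (a : A) (b : B) : MaxTensorProduct A B := of (a ⊗ₜ[ℂ] b)

end MaxTensorProduct

/-! ### Completely bounded maps -/

/-- A linear map between C⋆-algebras is completely bounded if its amplifications to matrices
of all sizes are uniformly bounded. -/
def IsCompletelyBounded {A B : Type*} [NonUnitalCStarAlgebra A] [PartialOrder A]
    [StarOrderedRing A] [NonUnitalCStarAlgebra B] [PartialOrder B] [StarOrderedRing B]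
    (f : A →ₗ[ℂ] B) : Prop :=
  ∃ C : ℝ, ∀ (n : ℕ) (X : CStarMatrix (Fin n) (Fin n) A), ‖X.map f‖ ≤ C * ‖X‖

/-! ### A von Neumann algebra as a C⋆-algebra -/

namespace VonNeumannAlgebra

variable {H : Type*} [NormedAddCommGroup H] [InnerProductSpace ℂ H] [CompleteSpace H]

instance instSMulMemClass : SMulMemClass (VonNeumannAlgebra H) ℂ (H →L[ℂ] H) where
  smul_mem {s} c _ hx := s.toStarSubalgebra.smul_mem hx c

theorem isClosed (M : VonNeumannAlgebra H) : IsClosed (M : Set (H →L[ℂ] H)) := by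
  rw [← M.centralizer_centralizer]
  exact Set.isClosed_centralizer _

instance instCStarAlgebra (M : VonNeumannAlgebra H) : CStarAlgebra M :=
  StarSubalgebra.cstarAlgebra M (h_closed := M.isClosed)

/-- The order inherited from the operator order of `B(H)` is the canonical order of the
C⋆-algebra `M`. -/
instance instStarOrderedRing (M : VonNeumannAlgebra H) : StarOrderedRing M := by
  refine StarOrderedRing.of_nonneg_iff' (fun {x y} hxy z => ?_) fun x => ⟨fun hx => ?_, ?_⟩
  · exact add_le_add_right (α := H →L[ℂ] H) hxy (z : H →L[ℂ] H)
  · have hx' : 0 ≤ (x : H →L[ℂ] H) := hx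
    have hmem : CFC.sqrt (x : H →L[ℂ] H) ∈ M := by
      rw [← SetLike.mem_coe, ← M.centralizer_centralizer]
      intro y hy
      have hc : Commute (x : H →L[ℂ] H) y := hy _ x.2
      exact (hc.cfcₙ_nnreal NNReal.sqrt).eq.symm
    refine ⟨⟨_, hmem⟩, Subtype.ext ?_⟩
    have hs : star (CFC.sqrt (x : H →L[ℂ] H)) = CFC.sqrt (x : H →L[ℂ] H) :=
      (IsSelfAdjoint.of_nonneg (CFC.sqrt_nonneg _)).star_eq
    change (x : H →L[ℂ] H) = star (CFC.sqrt (x : H →L[ℂ] H)) * CFC.sqrt (x : H →L[ℂ] H)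
    rw [hs, CFC.sqrt_mul_sqrt_self _ hx']
  · rintro ⟨s, rfl⟩
    exact star_mul_self_nonneg (s : H →L[ℂ] H)

end VonNeumannAlgebra

end

/-! ### Positive forms and the operators they induce -/

section Forms

open scoped ComplexOrder InnerProductSpace
open ComplexConjugate

variable {H : Type*} [NormedAddCommGroup H] [InnerProductSpace ℂ H] [CompleteSpace H]

/-! The substance is the return to (1), from the completely positive matrix (4) and from the
completely bounded extension (2). To make `φ` similar to a ⋆-homomorphism it suffices to find a
strictly positive `P ∈ M` with `φ(a) P = P φ(a⋆)⋆`, since conjugation by `√P` then does it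
(`exists_similar_of_isStrictlyPositive`). Both arguments first obtain a positive operator `N` on `H`
with this intertwining property.

The source of `N` is a positive form `s` on `B ⊗ H` for which left multiplications are bounded and
adjoint to each other, with a map `Q` into `H`, bounded for `s`, that turns left multiplication into
the representation. Then `N = Q Q⋆` intertwines, and Cauchy–Schwarz bounds it from below on the
vectors that `Q` reaches (`exists_operator_of_form`).

From (4), `s` is the Stinespring form `⟪k, φ₁(b⋆a) h⟫` and `Q(a ⊗ h) = φ(a) h`. Positivity of the
matrix and boundedness of `φ₂` give the bound on `Q`; unitaries of the commutant are isometric for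
`s`, so `N` commutes with `M'`. From (2), passage to the unitization makes the representation
unital; complete boundedness says that a system of linear inequalities is consistent, and a
Hahn–Banach argument yields `s`. Intertwining on `a ⊗ x` gives `φ(a)(xN - Nx) = 0` for `x ∈ M'`.

As `φ` may be degenerate, a weak limit `E` of `φ` along an approximate unit, an idempotent of `M`
usually not self-adjoint, replaces the identity: `P = E N E⋆ + (1 - E)(1 - E)⋆` lies in `M` and is
strictly positive (`VonNeumannAlgebra.exists_similar_of_operator`).

The remaining implications are algebraic: polarization of a `2 × 2` matrix, row conjugation of
completely positive maps, polar decomposition, and the universal property of the maximal tensor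
product. -/

/-- Extend `Q` to `q'` on the completion and take `N = q' q'⋆`. With `l`, `l'` the extensions of
`L`, `L'`, one has `x q' = q' l`, `y q' = q' l'` and `l = l'⋆`, so `x N = q' l q'⋆ = q' (q' l')⋆ = N
y⋆`. The last bound is Cauchy–Schwarz for `⟪q'⋆ k, ξ⟫`. -/
theorem exists_operator_of_preinner {F : Type*} [SeminormedAddCommGroup F]
    [InnerProductSpace ℂ F] (Q : F →ₗ[ℂ] H) (C : ℝ)
    (hQ : ∀ ξ, ‖Q ξ‖ ≤ C * ‖ξ‖) :
    ∃ N : H →L[ℂ] H, 0 ≤ N ∧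
      (∀ (L L' : F →ₗ[ℂ] F) (c : ℝ) (x y : H →L[ℂ] H), (∀ ξ, ‖L ξ‖ ≤ c * ‖ξ‖) →
        (∀ ξ, ‖L' ξ‖ ≤ c * ‖ξ‖) → (∀ ξ η, ⟪L ξ, η⟫_ℂ = ⟪ξ, L' η⟫_ℂ) →
        (∀ ξ, Q (L ξ) = x (Q ξ)) → (∀ ξ, Q (L' ξ) = y (Q ξ)) → x * N = N * star y) ∧
      ∀ k ξ, ‖⟪k, Q ξ⟫_ℂ‖ ^ 2 ≤ ‖ξ‖ ^ 2 * RCLike.re ⟪k, N k⟫_ℂ := by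
  let q : F →L[ℂ] H := Q.mkContinuous C hQ
  let K := UniformSpace.Completion F
  let q' : K →L[ℂ] H := ContinuousLinearMap.fromCompletion q
  have hq' (ξ : F) : q' (ξ : K) = Q ξ := ContinuousLinearMap.fromCompletion_apply_coe q ξ
  have hd : DenseRange ((↑) : F → K) := UniformSpace.Completion.denseRange_coe
  refine ⟨q' ∘L q'.adjoint, ?_, ?_, ?_⟩
  · rw [ContinuousLinearMap.nonneg_iff_isPositive]
    exact ContinuousLinearMap.isPositive_self_comp_adjoint q'
  · intro L L' c x y hL hL' hadj hx hy
    let l : K →L[ℂ] K := ContinuousLinearMap.fromCompletion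
      (UniformSpace.Completion.toComplL.comp (L.mkContinuous c hL))
    let l' : K →L[ℂ] K := ContinuousLinearMap.fromCompletion
      (UniformSpace.Completion.toComplL.comp (L'.mkContinuous c hL'))
    have hl (ξ : F) : l (ξ : K) = (L ξ : K) := ContinuousLinearMap.fromCompletion_apply_coe _ ξ
    have hl' (ξ : F) : l' (ξ : K) = (L' ξ : K) :=
      ContinuousLinearMap.fromCompletion_apply_coe _ ξ
    have e1 : x ∘L q' = q' ∘L l := by
      refine ContinuousLinearMap.ext fun k => ?_
      refine hd.induction_on k (isClosed_eq (by fun_prop) (by fun_prop)) fun ξ => ?_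
      simp [hl, hq', hx]
    have e2 : y ∘L q' = q' ∘L l' := by
      refine ContinuousLinearMap.ext fun k => ?_
      refine hd.induction_on k (isClosed_eq (by fun_prop) (by fun_prop)) fun ξ => ?_
      simp [hl', hq', hy]
    have e3 : l = l'.adjoint := by
      rw [ContinuousLinearMap.eq_adjoint_iff]
      intro a b
      refine hd.induction_on a (isClosed_eq (by fun_prop) (by fun_prop)) fun ξ => ?_
      refine hd.induction_on b (isClosed_eq (by fun_prop) (by fun_prop)) fun η => ?_
      rw [hl, hl', UniformSpace.Completion.inner_coe, UniformSpace.Completion.inner_coe, hadj]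
    change x ∘L (q' ∘L q'.adjoint) = (q' ∘L q'.adjoint) ∘L y.adjoint
    rw [ContinuousLinearMap.comp_assoc, ← ContinuousLinearMap.adjoint_comp, e2,
      ContinuousLinearMap.adjoint_comp, ← e3, ← ContinuousLinearMap.comp_assoc, e1,
      ContinuousLinearMap.comp_assoc]
  · intro k ξ
    have h1 : ⟪k, Q ξ⟫_ℂ = ⟪q'.adjoint k, (ξ : K)⟫_ℂ := by
      rw [ContinuousLinearMap.adjoint_inner_left, hq']
    have h2 : ⟪k, (q' ∘L q'.adjoint) k⟫_ℂ = ⟪q'.adjoint k, q'.adjoint k⟫_ℂ := by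
      rw [ContinuousLinearMap.adjoint_inner_left]; rfl
    rw [h1, h2, inner_self_eq_norm_sq, ← UniformSpace.Completion.norm_coe ξ, ← mul_pow, mul_comm]
    exact pow_le_pow_left₀ (norm_nonneg _) (norm_inner_le_norm _ _) 2

/-- Polarization: the diagonal values at `ξ + η` and `ξ + iη` are real, which fixes the imaginary
and real parts. -/
theorem LinearMap.conj_apply_of_nonneg {F : Type*} [AddCommGroup F] [Module ℂ F]
    (s : F →ₗ⋆[ℂ] F →ₗ[ℂ] ℂ) (hs : ∀ ξ, 0 ≤ s ξ ξ) (ξ η : F) : conj (s η ξ) = s ξ η := by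
  have im0 (ζ : F) : (s ζ ζ).im = 0 := ((Complex.nonneg_iff.mp (hs ζ)).2).symm
  have h1 := im0 (ξ + η)
  have h2 := im0 (ξ + Complex.I • η)
  simp [im0] at h1 h2
  apply Complex.ext
  · simp; linarith
  · simp; linarith

/-- The pre-inner product of a positive semidefinite form. -/
@[reducible]
def coreOfNonneg {F : Type*} [AddCommGroup F] [Module ℂ F]
    (s : F →ₗ⋆[ℂ] F →ₗ[ℂ] ℂ) (hs : ∀ ξ, 0 ≤ s ξ ξ) : PreInnerProductSpace.Core ℂ F where
  inner ξ η := s ξ η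
  conj_inner_symm ξ η := s.conj_apply_of_nonneg hs ξ η
  re_inner_nonneg ξ := (Complex.nonneg_iff.mp (hs ξ)).1
  add_left ξ η ζ := by simp
  smul_left ξ η c := by simp

theorem LinearMap.norm_apply_sq_le_of_nonneg {F : Type*} [AddCommGroup F] [Module ℂ F]
    (s : F →ₗ⋆[ℂ] F →ₗ[ℂ] ℂ) (hs : ∀ ξ, 0 ≤ s ξ ξ) (ξ η : F) :
    ‖s ξ η‖ ^ 2 ≤ (s ξ ξ).re * (s η η).re := by
  let c := coreOfNonneg s hs
  have h := InnerProductSpace.Core.inner_mul_inner_self_le (𝕜 := ℂ) ξ η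
  have e : (‖s ξ η‖ : ℝ) = ‖s η ξ‖ := by
    rw [← s.conj_apply_of_nonneg hs ξ η, RCLike.norm_conj]
  calc ‖s ξ η‖ ^ 2 = ‖s ξ η‖ * ‖s η ξ‖ := by rw [← e, sq]
    _ ≤ _ := h

/-- A positive semidefinite form `s` that dominates a linear map `Q` into a Hilbert space gives
the operator `N = Q Q⋆`, where the adjoint is taken with respect to `s`. -/
theorem exists_operator_of_form {F : Type*} [AddCommGroup F] [Module ℂ F]
    (s : F →ₗ⋆[ℂ] F →ₗ[ℂ] ℂ) (hs : ∀ ξ, 0 ≤ s ξ ξ) (Q : F →ₗ[ℂ] H) (C : ℝ) (hC : 0 ≤ C)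
    (hQ : ∀ ξ, ‖Q ξ‖ ^ 2 ≤ C * (s ξ ξ).re) :
    ∃ N : H →L[ℂ] H, 0 ≤ N ∧
      (∀ (L L' : F →ₗ[ℂ] F) (c : ℝ) (x y : H →L[ℂ] H), 0 ≤ c →
        (∀ ξ, (s (L ξ) (L ξ)).re ≤ c * (s ξ ξ).re) →
        (∀ ξ, (s (L' ξ) (L' ξ)).re ≤ c * (s ξ ξ).re) → (∀ ξ η, s (L ξ) η = s ξ (L' η)) →
        (∀ ξ, Q (L ξ) = x (Q ξ)) → (∀ ξ, Q (L' ξ) = y (Q ξ)) → x * N = N * star y) ∧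
      ∀ k ξ, ‖⟪k, Q ξ⟫_ℂ‖ ^ 2 ≤ (s ξ ξ).re * RCLike.re ⟪k, N k⟫_ℂ := by
  let c := coreOfNonneg s hs
  let : SeminormedAddCommGroup F := InnerProductSpace.Core.toSeminormedAddCommGroup (𝕜 := ℂ)
  let : InnerProductSpace ℂ F := InnerProductSpace.ofCore c
  have hn (ξ : F) : ‖ξ‖ ^ 2 = (s ξ ξ).re := by
    rw [@norm_sq_eq_re_inner ℂ]; rfl
  have key (a b d : ℝ) (ha : 0 ≤ a) (hd : 0 ≤ d) (hb : 0 ≤ b) (h : a ^ 2 ≤ b * d ^ 2) :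
      a ≤ √b * d := by
    refine abs_le_of_sq_le_sq' ?_ (by positivity) |>.2
    rwa [mul_pow, Real.sq_sqrt hb]
  obtain ⟨N, h0, h1, h2⟩ := exists_operator_of_preinner Q (√C) fun ξ =>
    key _ _ _ (norm_nonneg _) (norm_nonneg _) hC (by rw [hn]; exact hQ ξ)
  refine ⟨N, h0, fun L L' c x y hc hL hL' hadj hx hy => h1 L L' (√c) x y ?_ ?_ hadj hx hy, ?_⟩
  · exact fun ξ => key _ _ _ (norm_nonneg _) (norm_nonneg _) hc (by rw [hn, hn]; exact hL ξ)
  · exact fun ξ => key _ _ _ (norm_nonneg _) (norm_nonneg _) hc (by rw [hn, hn]; exact hL' ξ)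
  · intro k ξ
    rw [← hn]
    exact h2 k ξ

end Forms

/-! ### Sesquilinear kernels on `B ⊗ X` -/

section Kernel

open scoped ComplexOrder
open ComplexConjugate

variable {B : Type*} [NonUnitalCStarAlgebra B] {X V : Type*} [AddCommGroup X] [Module ℂ X]
  [AddCommGroup V] [Module ℂ V]

/-- The sesquilinear map `(b ⊗ k, a ⊗ h) ↦ t (b⋆ a) k h` on `B ⊗ X`. -/
noncomputable def kernelForm (t : B →ₗ[ℂ] X →ₗ⋆[ℂ] X →ₗ[ℂ] V) :
    B ⊗[ℂ] X →ₗ⋆[ℂ] B ⊗[ℂ] X →ₗ[ℂ] V :=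
  TensorProduct.lift <| LinearMap.mk₂'ₛₗ (starRingEnd ℂ) (starRingEnd ℂ)
    (fun b k => TensorProduct.lift <| LinearMap.mk₂ ℂ (fun a h => t (star b * a) k h)
      (by simp [mul_add]) (by simp [mul_smul_comm]) (by simp) (by simp))
    (fun _ _ _ => TensorProduct.ext' fun _ _ => by simp [add_mul])
    (fun _ _ _ => TensorProduct.ext' fun _ _ => by simp [smul_mul_assoc])
    (fun _ _ _ => TensorProduct.ext' fun _ _ => by simp)
    (fun _ _ _ => TensorProduct.ext' fun _ _ => by simp)

@[simp]
theorem kernelForm_tmul (t : B →ₗ[ℂ] X →ₗ⋆[ℂ] X →ₗ[ℂ] V) (a b : B) (h k : X) :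
    kernelForm t (b ⊗ₜ k) (a ⊗ₜ h) = t (star b * a) k h := rfl

variable (X) in
/-- Left multiplication by `c` on `B ⊗ X`. -/
noncomputable def leftMul (c : B) : B ⊗[ℂ] X →ₗ[ℂ] B ⊗[ℂ] X :=
  LinearMap.rTensor X (LinearMap.mul ℂ B c)

@[simp]
theorem leftMul_tmul (c a : B) (h : X) : leftMul X c (a ⊗ₜ h) = (c * a) ⊗ₜ h := rfl

theorem leftMul_mul (c d : B) (ξ : B ⊗[ℂ] X) :
    leftMul X (c * d) ξ = leftMul X c (leftMul X d ξ) := by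
  induction ξ using TensorProduct.induction_on with
  | zero => simp
  | tmul a h => simp [mul_assoc]
  | add x y hx hy => simp [hx, hy]

theorem leftMul_add (c d : B) (ξ : B ⊗[ℂ] X) :
    leftMul X (c + d) ξ = leftMul X c ξ + leftMul X d ξ := by
  simp [leftMul, LinearMap.rTensor_add]

theorem leftMul_smul (r : ℂ) (d : B) (ξ : B ⊗[ℂ] X) :
    leftMul X (r • d) ξ = r • leftMul X d ξ := by
  simp [leftMul, LinearMap.rTensor_smul]

theorem kernelForm_leftMul (t : B →ₗ[ℂ] X →ₗ⋆[ℂ] X →ₗ[ℂ] V) (c : B) (ξ η : B ⊗[ℂ] X) :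
    kernelForm t (leftMul X c ξ) η = kernelForm t ξ (leftMul X (star c) η) := by
  induction ξ using TensorProduct.induction_on with
  | zero => simp
  | add x y hx hy => simp [hx, hy]
  | tmul b k =>
    induction η using TensorProduct.induction_on with
    | zero => simp
    | add x y hx hy => simp only [map_add, hx, hy]
    | tmul a h => simp [mul_assoc]

/-- Serves two purposes: restricting a matrix-valued form to a corner, and letting the commutant act
on the second tensor factor. -/
theorem kernelForm_lTensor {Y : Type*} [AddCommGroup Y] [Module ℂ Y]
    (t : B →ₗ[ℂ] X →ₗ⋆[ℂ] X →ₗ[ℂ] V) (t' : B →ₗ[ℂ] Y →ₗ⋆[ℂ] Y →ₗ[ℂ] V)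
    (u v : Y →ₗ[ℂ] X) (w : Y →ₗ[ℂ] Y) (h : ∀ b k h, t b (u k) (v h) = t' b k (w h))
    (ξ η : B ⊗[ℂ] Y) :
    kernelForm t (LinearMap.lTensor B u ξ) (LinearMap.lTensor B v η) =
      kernelForm t' ξ (LinearMap.lTensor B w η) := by
  induction ξ using TensorProduct.induction_on with
  | zero => simp
  | add x y hx hy => simp [hx, hy]
  | tmul b k =>
    induction η using TensorProduct.induction_on with
    | zero => simp
    | add x y hx hy => simp only [map_add, hx, hy]
    | tmul a k => simp [h]

theorem exists_sum_tmul {R M N : Type*} [CommSemiring R] [AddCommMonoid M] [Module R M]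
    [AddCommMonoid N] [Module R N] (ξ : M ⊗[R] N) :
    ∃ (n : ℕ) (b : Fin n → M) (h : Fin n → N), ξ = ∑ i, b i ⊗ₜ[R] h i := by
  obtain ⟨S, rfl⟩ := TensorProduct.exists_finset ξ
  refine ⟨S.card, fun i => (S.equivFin.symm i).1.1, fun i => (S.equivFin.symm i).1.2, ?_⟩
  rw [← Finset.sum_coe_sort S]
  exact (Equiv.sum_comp S.equivFin.symm fun i : S => i.1.1 ⊗ₜ[R] i.1.2).symm

theorem kernelForm_nonneg (t : B →ₗ[ℂ] X →ₗ⋆[ℂ] X →ₗ[ℂ] ℂ)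
    (ht : ∀ (n : ℕ) (b : Fin n → B) (h : Fin n → X),
      0 ≤ ∑ i, ∑ j, t (star (b i) * b j) (h i) (h j)) (ξ : B ⊗[ℂ] X) :
    0 ≤ kernelForm t ξ ξ := by
  obtain ⟨n, b, h, rfl⟩ := exists_sum_tmul ξ
  refine (ht n b h).trans_eq ?_
  rw [Finset.sum_comm]
  simp [map_sum]

/-- Without a unit, `‖a‖² a⋆a = c⋆c + (a⋆a)²` replaces `a⋆a ≤ ‖a‖²`. With `q = s(aξ, aξ)`, it gives
`s(a⋆aξ, a⋆aξ) ≤ ‖a‖² q`; Cauchy–Schwarz gives `q² ≤ s(ξ, ξ) ‖a‖² q`, and `q` cancels. -/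
theorem kernelForm_leftMul_le (t : B →ₗ[ℂ] X →ₗ⋆[ℂ] X →ₗ[ℂ] ℂ)
    (ht : ∀ ξ, 0 ≤ kernelForm t ξ ξ) (a : B) (ξ : B ⊗[ℂ] X) :
    (kernelForm t (leftMul X a ξ) (leftMul X a ξ)).re ≤ ‖a‖ ^ 2 * (kernelForm t ξ ξ).re := by
  obtain ⟨c, hc⟩ := CStarSeminorm.exists_star_mul_self_add a
  set s := kernelForm t
  have pos (ξ) : 0 ≤ (s ξ ξ).re := (Complex.nonneg_iff.mp (ht ξ)).1
  have e (b : B) : s (leftMul X b ξ) (leftMul X b ξ) = s ξ (leftMul X (star b * b) ξ) := by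
    rw [kernelForm_leftMul, leftMul_mul]
  have h1 : ‖a‖ ^ 2 * (s (leftMul X a ξ) (leftMul X a ξ)).re =
      (s (leftMul X c ξ) (leftMul X c ξ)).re +
      (s (leftMul X (star a * a) ξ) (leftMul X (star a * a) ξ)).re := by
    have := congrArg (fun z => (s ξ (leftMul X z ξ)).re) hc
    simp only [leftMul_smul, leftMul_add, map_add, map_smul, smul_eq_mul, Complex.re_ofReal_mul,
      Complex.add_re] at this
    rw [e, e, e, this]
    simp
  have h2 := s.norm_apply_sq_le_of_nonneg ht ξ (leftMul X (star a * a) ξ)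
  rw [← e] at h2
  have h3 := Complex.re_le_norm (s (leftMul X a ξ) (leftMul X a ξ))
  have h4 := pos (leftMul X a ξ)
  have h5 := pos (leftMul X c ξ)
  have h6 := pos ξ
  set q := (s (leftMul X a ξ) (leftMul X a ξ)).re
  rcases h4.eq_or_lt with h | h
  · rw [← h]; positivity
  · have h7 : q * q ≤ ‖a‖ ^ 2 * (s ξ ξ).re * q := by
      calc q * q ≤ ‖s (leftMul X a ξ) (leftMul X a ξ)‖ ^ 2 := by
            rw [sq]; exact mul_self_le_mul_self h4 h3
        _ ≤ _ := h2
        _ ≤ (s ξ ξ).re * (‖a‖ ^ 2 * q) := by gcongr; linarith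
        _ = _ := by ring
    exact le_of_mul_le_mul_right h7 h

end Kernel

/-! ### Completely positive maps -/

section CP

variable {A B : Type*} [NonUnitalCStarAlgebra A] [PartialOrder A] [StarOrderedRing A]
  [NonUnitalCStarAlgebra B] [PartialOrder B] [StarOrderedRing B]

theorem CStarMatrix.sum_apply {m n ι R : Type*} [AddCommMonoid R] (s : Finset ι)
    (f : ι → CStarMatrix m n R) (i : m) (j : n) : (∑ k ∈ s, f k) i j = ∑ k ∈ s, f k i j := by
  classical
  induction s using Finset.induction_on with
  | empty => simp
  | insert a s ha ih => simp [Finset.sum_insert ha, ih]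

@[simp]
theorem CStarMatrix.ofMatrix_apply_apply {m n R : Type*} (f : m → n → R) (i : m) (j : n) :
    CStarMatrix.ofMatrix f i j = f i j := rfl

theorem exists_star_mul_self_of_nonneg {a : A} (ha : 0 ≤ a) : ∃ b : A, a = star b * b :=
  CStarAlgebra.nonneg_iff_eq_star_mul_self.mp ha

theorem CStarMatrix.nonneg_of_sum {n κ : Type*} [Fintype n] [Fintype κ] (Y : κ → n → A)
    (M : CStarMatrix n n A) (hM : ∀ i j, M i j = ∑ k, star (Y k i) * Y k j) : 0 ≤ M := by
  classical
  rcases isEmpty_or_nonempty n with hn | ⟨⟨i₀⟩⟩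
  · exact (CStarMatrix.ext fun i => hn.elim i : (0 : CStarMatrix n n A) = M).le
  -- Each family `Y k` becomes the only nonzero row of a square matrix, so that `M` is a sum of
  -- squares; an empty index type has no row to use.
  let Z (k : κ) : CStarMatrix n n A := CStarMatrix.ofMatrix fun i j => if i = i₀ then Y k j else 0
  have : M = ∑ k, star (Z k) * Z k := by
    ext i j
    rw [hM, CStarMatrix.sum_apply]
    refine Finset.sum_congr rfl fun k _ => ?_
    simp [CStarMatrix.mul_apply, CStarMatrix.star_apply, Z]
  rw [this]
  exact Finset.sum_nonneg fun k _ => star_mul_self_nonneg _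

theorem CStarMatrix.exists_sum_of_nonneg {n : Type*} [Fintype n] {M : CStarMatrix n n A}
    (hM : 0 ≤ M) : ∃ Y : n → n → A, ∀ i j, M i j = ∑ k, star (Y k i) * Y k j := by
  obtain ⟨X, rfl⟩ := exists_star_mul_self_of_nonneg hM
  exact ⟨X, fun i j => by simp [CStarMatrix.mul_apply, CStarMatrix.star_apply]⟩

/-- The completely positive map with given underlying linear map, provided that its amplifications
factor through sums of squares. -/
def CompletelyPositiveMap.ofSum (f : A →ₗ[ℂ] B)
    (h : ∀ (n : ℕ) (M : CStarMatrix (Fin n) (Fin n) A), 0 ≤ M → ∃ (κ : Type) (_ : Fintype κ)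
      (Y : κ → Fin n → B), ∀ i j, f (M i j) = ∑ k, star (Y k i) * Y k j) : A →CP B where
  toLinearMap := f
  map_cstarMatrix_nonneg' n M hM := by
    obtain ⟨κ, _, Y, hY⟩ := h n M hM
    exact CStarMatrix.nonneg_of_sum Y _ hY

theorem CompletelyPositiveMap.exists_sum (f : A →CP B) (n : ℕ)
    (M : CStarMatrix (Fin n) (Fin n) A) (hM : 0 ≤ M) :
    ∃ Y : Fin n → Fin n → B, ∀ i j, f (M i j) = ∑ k, star (Y k i) * Y k j :=
  CStarMatrix.exists_sum_of_nonneg (f.map_cstarMatrix_nonneg M hM)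

theorem CompletelyPositiveMap.exists_sum_of_family (f : A →CP B) (n : ℕ) (b : Fin n → A) :
    ∃ Y : Fin n → Fin n → B, ∀ i j, f (star (b i) * b j) = ∑ k, star (Y k i) * Y k j :=
  f.exists_sum n (CStarMatrix.ofMatrix fun i j => star (b i) * b j)
    (CStarMatrix.nonneg_of_sum (κ := Unit) (fun _ => b) _ (by simp))

theorem CompletelyPositiveMap.exists_norm_le (f : A →CP B) :
    ∃ C : ℝ, 0 ≤ C ∧ ∀ a, ‖f a‖ ≤ C * ‖a‖ := by
  obtain ⟨C, hC⟩ := PositiveLinearMap.exists_norm_apply_le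
    ({ (f : A →ₗ[ℂ] B) with monotone' := OrderHomClass.mono f } : A →ₚ[ℂ] B)
  exact ⟨C, C.2, hC⟩

theorem CompletelyPositiveMap.map_star' (f : A →CP B) (a : A) : f (star a) = star (f a) := by
  let g : A →ₚ[ℂ] B := { (f : A →ₗ[ℂ] B) with monotone' := OrderHomClass.mono f }
  exact map_star g a

/-- The completely positive map `a ↦ ∑ i, Tᵢ⋆ ψᵢ(a) Tᵢ`. -/
noncomputable def CompletelyPositiveMap.conjSum {n : ℕ} (ψ : Fin n → (A →CP B)) (T : Fin n → B) :
    A →CP B :=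
  .ofSum (∑ i, LinearMap.mulLeft ℂ (star (T i)) ∘ₗ LinearMap.mulRight ℂ (T i) ∘ₗ
      (ψ i).toLinearMap) fun m M hM => by
    choose Y hY using fun i => (ψ i).exists_sum m M hM
    refine ⟨Fin n × Fin m, inferInstance, fun k j => Y k.1 k.2 j * T k.1, fun i j => ?_⟩
    have hY' (k i j) : (ψ k).toLinearMap (M i j) = ∑ l, star (Y k l i) * Y k l j := hY k i j
    simp only [LinearMap.sum_apply, LinearMap.coe_comp, Function.comp_apply, hY',
      LinearMap.mulRight_apply, LinearMap.mulLeft_apply, star_mul, Fintype.sum_prod_type,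
      Finset.mul_sum, Finset.sum_mul, mul_assoc]

@[simp]
theorem CompletelyPositiveMap.conjSum_apply {n : ℕ} (ψ : Fin n → (A →CP B)) (T : Fin n → B)
    (a : A) : conjSum ψ T a = ∑ i, star (T i) * (ψ i a * T i) := by
  change (∑ i, LinearMap.mulLeft ℂ (star (T i)) ∘ₗ LinearMap.mulRight ℂ (T i) ∘ₗ
      (ψ i).toLinearMap) a = _
  simp [LinearMap.sum_apply]; rfl

/-- The `2 × 2` matrix `∑ i, (Sᵢ Tᵢ)⋆ ψᵢ(a) (Sᵢ Tᵢ)` is completely positive in `a`. -/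
theorem CompletelyPositiveMap.exists_rowConjSum {n : ℕ} (ψ : Fin n → (A →CP B)) (S T : Fin n → B) :
    ∃ Ψ : A →CP CStarMatrix (Fin 2) (Fin 2) B, ∀ a, Ψ a = CStarMatrix.ofMatrix
      !![∑ i, star (S i) * (ψ i a * S i), ∑ i, star (S i) * (ψ i a * T i);
        ∑ i, star (T i) * (ψ i a * S i), ∑ i, star (T i) * (ψ i a * T i)] := by
  let V : Fin n → Fin 2 → B := fun i => ![S i, T i]
  let f : A →ₗ[ℂ] CStarMatrix (Fin 2) (Fin 2) B :=
    { toFun := fun a => CStarMatrix.ofMatrix fun p q => ∑ i, star (V i p) * (ψ i a * V i q)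
      map_add' := fun a b => by
        ext p q; simp [add_mul, mul_add, Finset.sum_add_distrib]
      map_smul' := fun c a => by
        ext p q; simp [Finset.smul_sum, smul_mul_assoc, mul_smul_comm] }
  refine ⟨.ofSum f fun m M hM => ?_, fun a => ?_⟩
  · choose Y hY using fun i => (ψ i).exists_sum m M hM
    refine ⟨Fin n × Fin m, inferInstance, fun k j => CStarMatrix.ofMatrix
      fun r q => if r = 0 then Y k.1 k.2 j * V k.1 q else 0, fun i j => ?_⟩
    ext p q
    simp [f, hY, CStarMatrix.sum_apply, CStarMatrix.mul_apply, CStarMatrix.star_apply,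
      Fintype.sum_prod_type, Finset.mul_sum, Finset.sum_mul, mul_assoc]
  · change f a = _
    ext p q
    fin_cases p <;> fin_cases q <;> simp [f, V]

/-- Compression of a matrix-valued completely positive map to a scalar vector. -/
theorem CompletelyPositiveMap.exists_compress (Ψ : A →CP CStarMatrix (Fin 2) (Fin 2) B)
    (v : Fin 2 → ℂ) :
    ∃ f : A →CP B, ∀ a, f a = ∑ p, ∑ q, (star (v p) * v q) • Ψ a p q := by
  let f : A →ₗ[ℂ] B :=
    { toFun := fun a => ∑ p, ∑ q, (star (v p) * v q) • Ψ a p q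
      map_add' := fun a b => by simp [Finset.sum_add_distrib]
      map_smul' := fun c a => by
        simp only [map_smul, CStarMatrix.smul_apply, Finset.smul_sum, RingHom.id_apply]
        simp only [smul_comm c] }
  refine ⟨.ofSum f fun m M hM => ?_, fun a => rfl⟩
  obtain ⟨Y, hY⟩ := Ψ.exists_sum m M hM
  refine ⟨Fin m × Fin 2, inferInstance, fun k j => ∑ q, v q • Y k.1 j k.2 q, fun i j => ?_⟩
  simp only [f, LinearMap.coe_mk, AddHom.coe_mk, hY, CStarMatrix.sum_apply, CStarMatrix.mul_apply,
    CStarMatrix.star_apply, Fintype.sum_prod_type, star_sum, star_smul, Finset.sum_mul,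
    Finset.mul_sum, smul_mul_smul_comm, Finset.smul_sum]
  simp only [Fin.sum_univ_two, ← Finset.sum_add_distrib]
  refine Finset.sum_congr rfl fun k _ => ?_
  abel

end CP

/-! ### Positive matrices of operators -/

section Operators

open scoped ComplexOrder InnerProductSpace

variable {H : Type*} [NormedAddCommGroup H] [InnerProductSpace ℂ H] [CompleteSpace H]

theorem sum_inner_star_mul {ι κ : Type*} [Fintype ι] [Fintype κ]
    (Y : κ → ι → H →L[ℂ] H) (h : ι → H) :
    ∑ i, ∑ j, ⟪h i, (∑ k, star (Y k i) * Y k j) (h j)⟫_ℂ =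
      ((∑ k, ‖∑ j, Y k j (h j)‖ ^ 2 : ℝ) : ℂ) := by
  have h1 (k : κ) : ((‖∑ j, Y k j (h j)‖ ^ 2 : ℝ) : ℂ) =
      ∑ i, ∑ j, ⟪h i, (star (Y k i) * Y k j) (h j)⟫_ℂ := by
    have h2 := inner_self_eq_norm_sq_to_K (𝕜 := ℂ) (∑ j, Y k j (h j))
    rw [Complex.ofReal_pow]
    refine h2.symm.trans ?_
    simp only [inner_sum, sum_inner, mul_apply_eq_comp, ContinuousLinearMap.star_eq_adjoint,
      ContinuousLinearMap.adjoint_inner_right]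
    exact Finset.sum_comm
  rw [Complex.ofReal_sum, Finset.sum_congr rfl fun k (_ : k ∈ Finset.univ) => h1 k,
    Finset.sum_comm (s := (Finset.univ : Finset κ))]
  refine Finset.sum_congr rfl fun i _ => ?_
  rw [Finset.sum_comm (s := (Finset.univ : Finset κ))]
  refine Finset.sum_congr rfl fun j _ => ?_
  rw [sum_apply, inner_sum]

theorem sum_inner_nonneg_of_sum {ι κ : Type*} [Fintype ι] [Fintype κ]
    (Y : κ → ι → H →L[ℂ] H) (T : ι → ι → H →L[ℂ] H)
    (hT : ∀ i j, T i j = ∑ k, star (Y k i) * Y k j) (h : ι → H) :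
    0 ≤ ∑ i, ∑ j, ⟪h i, T i j (h j)⟫_ℂ := by
  simp only [hT]
  rw [sum_inner_star_mul, Complex.zero_le_real]
  positivity

theorem norm_smul_one_sub_star_mul_self_nonneg {D : Type*} [CStarAlgebra D] [PartialOrder D]
    [StarOrderedRing D] (x : D) : 0 ≤ ((‖x‖ ^ 2 : ℝ) : ℂ) • (1 : D) - star x * x := by
  have := CStarAlgebra.star_mul_le_algebraMap_norm_sq (a := x)
  rw [sub_nonneg, Complex.coe_smul, ← Algebra.algebraMap_eq_smul_one]
  exact this

/-- Pairing the sum of squares `‖T‖² - T⋆T` with `h` gives the bound, so matrices need not be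
identified with operators on a direct sum. -/
theorem CStarMatrix.sum_norm_sq_le {n : Type*} [Fintype n] [DecidableEq n]
    (T : CStarMatrix n n (H →L[ℂ] H)) (h : n → H) :
    ∑ i, ‖∑ j, T i j (h j)‖ ^ 2 ≤ ‖T‖ ^ 2 * ∑ i, ‖h i‖ ^ 2 := by
  obtain ⟨Y, hY⟩ := CStarMatrix.exists_sum_of_nonneg (norm_smul_one_sub_star_mul_self_nonneg T)
  have h1 := sum_inner_nonneg_of_sum Y _ hY h
  have h2 := sum_inner_star_mul (fun k i => T k i) h
  have h3 : ∑ i, ∑ j, ⟪h i, (((‖T‖ ^ 2 : ℝ) : ℂ) • (1 : CStarMatrix n n (H →L[ℂ] H)))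
      i j (h j)⟫_ℂ = ((‖T‖ ^ 2 * ∑ i, ‖h i‖ ^ 2 : ℝ) : ℂ) := by
    push_cast
    rw [Finset.mul_sum]
    refine Finset.sum_congr rfl fun i _ => ?_
    rw [Finset.sum_eq_single i]
    · simp
    · intro j _ hj
      simp [CStarMatrix.one_apply_ne hj.symm]
    · simp
  simp only [CStarMatrix.sub_apply, _root_.sub_apply, inner_sub_right,
    Finset.sum_sub_distrib] at h1
  rw [h3] at h1
  simp only [CStarMatrix.mul_apply, CStarMatrix.star_apply] at h1
  rw [h2, ← Complex.ofReal_sub, Complex.zero_le_real] at h1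
  linarith

end Operators

/-! ### Similarity to a ⋆-homomorphism inside a C⋆-algebra -/

section Similarity

variable {A D : Type*} [NonUnitalCStarAlgebra A] [CStarAlgebra D] [PartialOrder D]
  [StarOrderedRing D]

/-- Conjugation of a homomorphism by an invertible element, provided that the outcome is
⋆-preserving. -/
noncomputable def conjStarHom (φ : A →ₙₐ[ℂ] D) (S : Dˣ)
    (h : ∀ a, (S : D) * φ (star a) * ↑S⁻¹ = star ((S : D) * φ a * ↑S⁻¹)) : A →⋆ₙₐ[ℂ] D where
  toFun a := (S : D) * φ a * ↑S⁻¹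
  map_smul' c a := by simp only [map_smul, mul_smul_comm, smul_mul_assoc]; rfl
  map_zero' := by simp
  map_add' a b := by simp [mul_add, add_mul]
  map_mul' a b := by
    rw [map_mul]
    simp only [mul_assoc, Units.inv_mul_cancel_left]
  map_star' := h

/-- For `T = √P`, the intertwining relation is exactly the statement that `T⁻¹ φ(·) T` preserves
stars. -/
theorem exists_similar_of_isStrictlyPositive (φ : A →ₙₐ[ℂ] D) (P : D)
    (hP : IsStrictlyPositive P) (h : ∀ a, φ a * P = P * star (φ (star a))) :
    ∃ (T : Dˣ) (π : A →⋆ₙₐ[ℂ] D), 0 ≤ (T : D) ∧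
      ∀ a, φ a = (T : D) * π a * ((T⁻¹ : Dˣ) : D) := by
  obtain ⟨u, hu⟩ := hP.isUnit_cfcSqrt
  have huu : (u : D) * u = P := by rw [hu]; exact CFC.sqrt_mul_sqrt_self P hP.nonneg
  have hus : star (u : D) = u := by
    rw [hu]; exact (IsSelfAdjoint.of_nonneg (CFC.sqrt_nonneg P)).star_eq
  have hus' : star ((u⁻¹ : Dˣ) : D) = ((u⁻¹ : Dˣ) : D) := by
    rw [← Units.coe_star_inv, show star u = u from Units.ext hus]
  refine ⟨u, conjStarHom φ u⁻¹ fun a => ?_, hu ▸ CFC.sqrt_nonneg P, fun a => ?_⟩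
  · have h1 : φ (star a) * (u * u) = u * u * star (φ a) := by simpa [huu] using h (star a)
    rw [inv_inv, star_mul, star_mul, hus, hus', mul_assoc, Units.inv_mul_eq_iff_eq_mul,
      ← mul_assoc, ← mul_assoc, Units.eq_mul_inv_iff_mul_eq, mul_assoc, h1]
  · change φ a = (u : D) * (((u⁻¹ : Dˣ) : D) * φ a * ((u⁻¹⁻¹ : Dˣ) : D)) * ((u⁻¹ : Dˣ) : D)
    simp [← mul_assoc]

/-- Polar decomposition: the invertible element implementing a similarity may be taken positive. -/
theorem exists_similar_nonneg (φ : A →ₙₐ[ℂ] D) (S : Dˣ) (π : A →⋆ₙₐ[ℂ] D)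
    (h : ∀ a, π a = (S : D) * φ a * ((S⁻¹ : Dˣ) : D)) :
    ∃ (T : Dˣ) (ρ : A →⋆ₙₐ[ℂ] D), 0 ≤ (T : D) ∧
      ∀ a, φ a = (T : D) * ρ a * ((T⁻¹ : Dˣ) : D) := by
  have h' (a : A) : φ a = ((S⁻¹ : Dˣ) : D) * π a * S := by rw [h]; simp [← mul_assoc]
  have hs : (S : D) * ((S⁻¹ : Dˣ) : D) = 1 := S.mul_inv
  have hs' : star ((S⁻¹ : Dˣ) : D) * star (S : D) = 1 := by rw [← star_mul, hs, star_one]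
  -- With `P = S⁻¹(S⁻¹)⋆`, both sides of the intertwining relation are `S⁻¹ π(a) (S⁻¹)⋆`.
  refine exists_similar_of_isStrictlyPositive φ (((S⁻¹ : Dˣ) : D) * star ((S⁻¹ : Dˣ) : D))
    (IsUnit.isStrictlyPositive ?_ (mul_star_self_nonneg _)) fun a => ?_
  · exact (S⁻¹).isUnit.mul (S⁻¹).isUnit.star
  · rw [h', h', star_mul, star_mul, ← map_star, star_star]
    calc ((S⁻¹ : Dˣ) : D) * π a * S * (((S⁻¹ : Dˣ) : D) * star ((S⁻¹ : Dˣ) : D))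
        = ((S⁻¹ : Dˣ) : D) * π a * ((S : D) * ((S⁻¹ : Dˣ) : D)) * star ((S⁻¹ : Dˣ) : D) := by
          simp only [mul_assoc]
      _ = ((S⁻¹ : Dˣ) : D) * (star ((S⁻¹ : Dˣ) : D) * star (S : D)) *
          (π a * star ((S⁻¹ : Dˣ) : D)) := by
          rw [hs, hs', mul_one, mul_one, mul_assoc]
      _ = _ := by simp only [mul_assoc]

end Similarity

/-! ### Weak limits of bounded nets of operators -/

section WeakLimit

open scoped InnerProductSpace
open Filter Topology

variable {H : Type*} [NormedAddCommGroup H] [InnerProductSpace ℂ H] [CompleteSpace H]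

/-- Matrix coefficients eventually lie in a compact disc and so converge along an ultrafilter; the
limits form a bounded sesquilinear form, represented by an operator. -/
theorem exists_weak_limit {ι : Type*} (U : Ultrafilter ι) (T : ι → H →L[ℂ] H) (C : ℝ)
    (hT : ∀ᶠ i in (U : Filter ι), ‖T i‖ ≤ C) :
    ∃ E : H →L[ℂ] H, ∀ k h, Tendsto (fun i => ⟪k, T i h⟫_ℂ) U (𝓝 ⟪k, E h⟫_ℂ) := by
  have bd (k h : H) : ∀ᶠ i in (U : Filter ι), ‖⟪k, T i h⟫_ℂ‖ ≤ C * ‖k‖ * ‖h‖ := by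
    filter_upwards [hT] with i hi
    calc ‖⟪k, T i h⟫_ℂ‖ ≤ ‖k‖ * ‖T i h‖ := norm_inner_le_norm _ _
      _ ≤ ‖k‖ * (C * ‖h‖) := by gcongr; exact (T i).le_of_opNorm_le hi h
      _ = _ := by ring
  have lim (k h : H) : ∃ z : ℂ, Tendsto (fun i => ⟪k, T i h⟫_ℂ) U (𝓝 z) := by
    obtain ⟨z, -, hz⟩ := (isCompact_closedBall (0 : ℂ) (C * ‖k‖ * ‖h‖)).ultrafilter_le_nhds
      (U.map fun i => ⟪k, T i h⟫_ℂ) (by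
        rw [le_principal_iff, Ultrafilter.mem_coe, Ultrafilter.mem_map]
        filter_upwards [bd k h] with i hi
        simpa using hi)
    exact ⟨z, hz⟩
  choose b hb using lim
  let B : H →ₗ⋆[ℂ] H →ₗ[ℂ] ℂ := LinearMap.mk₂'ₛₗ (starRingEnd ℂ) (RingHom.id ℂ) b
    (fun k k' h => tendsto_nhds_unique (hb _ _)
      (by simpa [inner_add_left] using (hb k h).add (hb k' h)))
    (fun c k h => tendsto_nhds_unique (hb _ _)
      (by simpa [inner_smul_left, mul_comm] using (hb k h).const_mul ((starRingEnd ℂ) c)))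
    (fun k h h' => tendsto_nhds_unique (hb _ _)
      (by simpa [inner_add_right] using (hb k h).add (hb k h')))
    (fun c k h => tendsto_nhds_unique (hb _ _)
      (by simpa [inner_smul_right] using (hb k h).const_mul c))
  let B' : H →L⋆[ℂ] H →L[ℂ] ℂ := B.mkContinuous₂ C fun k h =>
    le_of_tendsto (hb k h).norm (bd k h)
  refine ⟨(InnerProductSpace.continuousLinearMapOfBilin B').adjoint, fun k h => ?_⟩
  rw [ContinuousLinearMap.adjoint_inner_right,
    InnerProductSpace.continuousLinearMapOfBilin_apply]
  exact hb k h

end WeakLimit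

/-! ### The support idempotent of a bounded representation -/

namespace VonNeumannAlgebra

open scoped InnerProductSpace
open Filter Topology

variable {H : Type*} [NormedAddCommGroup H] [InnerProductSpace ℂ H] [CompleteSpace H]
  {A : Type*} [NonUnitalCStarAlgebra A]

theorem mem_of_commute (M : VonNeumannAlgebra H) {z : H →L[ℂ] H}
    (h : ∀ x ∈ M.commutant, x * z = z * x) : z ∈ M := by
  rw [← M.commutant_commutant, mem_commutant_iff]
  exact h

theorem commute_of_mem (M : VonNeumannAlgebra H) {z x : H →L[ℂ] H} (hz : z ∈ M)
    (hx : x ∈ M.commutant) : x * z = z * x :=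
  (mem_commutant_iff.mp hx z hz).symm

/-- `E` is a weak limit of `φ(e)` along an approximate unit. Commutation with `M'` passes to weak
limits, and norm continuity of `φ` gives `E φ(a) = φ(a) = φ(a) E`. -/
theorem exists_support_idempotent [PartialOrder A] [StarOrderedRing A] (M : VonNeumannAlgebra H)
    (φ : A →ₙₐ[ℂ] M)
    (hφ : ∃ C : ℝ, ∀ a : A, ‖φ a‖ ≤ C * ‖a‖) :
    ∃ (E : M) (l : Filter A), l.NeBot ∧ l.IsIncreasingApproximateUnit ∧
      (∀ a, E * φ a = φ a) ∧ (∀ a, φ a * E = φ a) ∧ E * E = E ∧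
      ∀ k h : H, Tendsto (fun e => ⟪k, (φ e : H →L[ℂ] H) h⟫_ℂ) l
        (𝓝 ⟪k, (E : H →L[ℂ] H) h⟫_ℂ) := by
  obtain ⟨C, hC⟩ := hφ
  have hφc : Continuous φ :=
    AddMonoidHomClass.continuous_of_bound (φ : A →+ M) C hC
  let U : Ultrafilter A := Ultrafilter.of (CStarAlgebra.approximateUnit A)
  have hU : (U : Filter A) ≤ CStarAlgebra.approximateUnit A := Ultrafilter.of_le _
  have hl := CStarAlgebra.increasingApproximateUnit A
  have hUl : (U : Filter A).IsIncreasingApproximateUnit :=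
    { tendsto_mul_left := fun m => (hl.tendsto_mul_left m).mono_left hU
      tendsto_mul_right := fun m => (hl.tendsto_mul_right m).mono_left hU
      neBot := U.neBot
      eventually_nonneg := hl.eventually_nonneg.filter_mono hU
      eventually_norm := hl.eventually_norm.filter_mono hU }
  obtain ⟨E, hE⟩ := exists_weak_limit U (fun e => (φ e : H →L[ℂ] H)) |C| (by
    filter_upwards [hUl.eventually_norm] with e he
    calc ‖(φ e : H →L[ℂ] H)‖ = ‖φ e‖ := rfl
      _ ≤ C * ‖e‖ := hC e
      _ ≤ |C| * 1 := by gcongr; exact le_abs_self C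
      _ = |C| := mul_one _)
  have ext {S T : H →L[ℂ] H} (h : ∀ k v, ⟪k, S v⟫_ℂ = ⟪k, T v⟫_ℂ) : S = T :=
    ContinuousLinearMap.ext fun v => ext_inner_left ℂ fun k => h k v
  have hEM : E ∈ M := by
    refine M.mem_of_commute fun x hx => ext fun k v => ?_
    refine tendsto_nhds_unique (f := fun e => ⟪star x k, (φ e : H →L[ℂ] H) v⟫_ℂ) (l := U) ?_ ?_
    · simpa [ContinuousLinearMap.star_eq_adjoint, ContinuousLinearMap.adjoint_inner_left] using
        hE (star x k) v
    · refine (hE k (x v)).congr fun e => ?_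
      rw [ContinuousLinearMap.star_eq_adjoint, ContinuousLinearMap.adjoint_inner_left]
      exact congrArg (fun S : H →L[ℂ] H => ⟪k, S v⟫_ℂ) (M.commute_of_mem (φ e).2 hx).symm
  have hc (k v : H) : Continuous fun S : M => ⟪k, (S : H →L[ℂ] H) v⟫_ℂ := by
    have : Continuous fun S : M => (S : H →L[ℂ] H) := continuous_subtype_val
    fun_prop
  have h1 (a : A) : E * (φ a : H →L[ℂ] H) = φ a := by
    refine ext fun k v => tendsto_nhds_unique (hE k ((φ a : H →L[ℂ] H) v)) ?_
    have := ((hc k v).comp hφc).tendsto a |>.comp (hUl.tendsto_mul_right a)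
    refine this.congr fun e => ?_
    simp
  have h2 (a : A) : (φ a : H →L[ℂ] H) * E = φ a := by
    refine ext fun k v => tendsto_nhds_unique (f := fun e =>
      ⟪star (φ a : H →L[ℂ] H) k, (φ e : H →L[ℂ] H) v⟫_ℂ) (l := U) ?_ ?_
    · simpa [ContinuousLinearMap.star_eq_adjoint, ContinuousLinearMap.adjoint_inner_left] using
        hE (star (φ a : H →L[ℂ] H) k) v
    · have := ((hc k v).comp hφc).tendsto a |>.comp (hUl.tendsto_mul_left a)
      refine this.congr fun e => ?_
      simp [ContinuousLinearMap.star_eq_adjoint, ContinuousLinearMap.adjoint_inner_left]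
  -- The coefficient `⟪E⋆k, φ(e) v⟫ = ⟪k, E φ(e) v⟫ = ⟪k, φ(e) v⟫` tends both to `⟪k, E E v⟫` and to
  -- `⟪k, E v⟫`.
  have h3 : E * E = E := by
    refine ext fun k v => tendsto_nhds_unique (f := fun e =>
      ⟪k, (φ e : H →L[ℂ] H) v⟫_ℂ) (l := U) ?_ (hE k v)
    have := hE (star E k) v
    simp only [ContinuousLinearMap.star_eq_adjoint, ContinuousLinearMap.adjoint_inner_left] at this
    refine this.congr fun e => ?_
    exact congrArg (fun S : H →L[ℂ] H => ⟪k, S v⟫_ℂ) (h1 e)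
  exact ⟨⟨E, hEM⟩, U, U.neBot, hUl, fun a => Subtype.ext (h1 a), fun a => Subtype.ext (h2 a),
    Subtype.ext h3, hE⟩

/-- `N` itself is not assumed to lie in `M` or to be invertible. Its compression `E N E⋆` lies in
`M`, because the relation `φ(a)(xN - Nx) = 0` passes to the weak limit `E`. Adding `(1 - E)(1 - E)⋆`
restores invertibility and keeps the intertwining relation, as `φ` annihilates `1 - E`. -/
theorem exists_similar_of_operator (M : VonNeumannAlgebra H) (φ : A →ₙₐ[ℂ] M) (E : M)
    (hE : ∀ a, E * φ a = φ a) (hE' : ∀ a, φ a * E = φ a) (hEE : E * E = E)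
    (l : Filter A) [l.NeBot]
    (hl : ∀ k h : H, Tendsto (fun e => ⟪k, (φ e : H →L[ℂ] H) h⟫_ℂ) l
        (𝓝 ⟪k, (E : H →L[ℂ] H) h⟫_ℂ))
    (N : H →L[ℂ] H) (hN : 0 ≤ N) (c : ℝ) (hc : 0 < c)
    (hNE : ∀ k, c * ‖star (E : H →L[ℂ] H) k‖ ^ 2 ≤ RCLike.re ⟪k, N k⟫_ℂ)
    (hφN : ∀ a, (φ a : H →L[ℂ] H) * N = N * star (φ (star a) : H →L[ℂ] H))
    (hcomm : ∀ a, ∀ x ∈ M.commutant, (φ a : H →L[ℂ] H) * (x * N - N * x) = 0) :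
    ∃ (S : (↥M)ˣ) (π : A →⋆ₙₐ[ℂ] M), ∀ a, π a = (S : M) * φ a * ((S⁻¹ : (↥M)ˣ) : M) := by
  suffices ∃ (T : (↥M)ˣ) (π : A →⋆ₙₐ[ℂ] M), 0 ≤ (T : M) ∧
      ∀ a, φ a = (T : M) * π a * ((T⁻¹ : (↥M)ˣ) : M) by
    obtain ⟨T, π, -, h⟩ := this
    exact ⟨T⁻¹, π, fun a => by rw [h]; simp [← mul_assoc]⟩
  have hEcomm : ∀ x ∈ M.commutant, (E : H →L[ℂ] H) * (x * N - N * x) = 0 := by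
    intro x hx
    refine ContinuousLinearMap.ext fun v => ext_inner_left ℂ fun k => ?_
    refine tendsto_nhds_unique (hl k ((x * N - N * x) v)) ?_
    refine tendsto_const_nhds.congr fun e => ?_
    exact congrArg (fun S : H →L[ℂ] H => ⟪k, S v⟫_ℂ) (hcomm e x hx).symm
  have hmem : (E : H →L[ℂ] H) * N * star (E : H →L[ℂ] H) ∈ M := by
    refine M.mem_of_commute fun x hx => ?_
    have h1 := M.commute_of_mem E.2 hx
    have h2 := M.commute_of_mem (star_mem E.2) hx
    have h3 : (E : H →L[ℂ] H) * (x * N) = E * (N * x) := by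
      rw [← sub_eq_zero, ← mul_sub, hEcomm x hx]
    calc x * ((E : H →L[ℂ] H) * N * star (E : H →L[ℂ] H))
        = (x * E) * N * star (E : H →L[ℂ] H) := by simp only [mul_assoc]
      _ = (E : H →L[ℂ] H) * (x * N) * star (E : H →L[ℂ] H) := by rw [h1]; simp only [mul_assoc]
      _ = (E : H →L[ℂ] H) * N * (x * star (E : H →L[ℂ] H)) := by rw [h3]; simp only [mul_assoc]
      _ = _ := by rw [h2]; simp only [mul_assoc]
  let N₀ : M := ⟨_, hmem⟩
  let P : M := N₀ + (1 - E) * star (1 - E)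
  have hEstar (k : H) : star (E : H →L[ℂ] H) (star (E : H →L[ℂ] H) k) =
      star (E : H →L[ℂ] H) k := by
    have : star (E : H →L[ℂ] H) * star (E : H →L[ℂ] H) = star (E : H →L[ℂ] H) := by
      rw [← star_mul]; exact congrArg star (congrArg Subtype.val hEE)
    exact congrArg (fun S : H →L[ℂ] H => S k) this
  -- The `2` comes from `‖k‖² ≤ 2(‖E⋆k‖² + ‖k - E⋆k‖²)`; the two summands of `P` dominate `c‖E⋆k‖²`
  -- and `‖k - E⋆k‖²`.
  set c' := min c 1 / 2 with hc'
  have hc'0 : 0 < c' := by positivity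
  have hPle : algebraMap ℝ M c' ≤ P := by
    have hP' : (algebraMap ℝ (H →L[ℂ] H) c') ≤ (E : H →L[ℂ] H) * N * star (E : H →L[ℂ] H) +
        (1 - (E : H →L[ℂ] H)) * star (1 - (E : H →L[ℂ] H)) := by
      rw [← sub_nonneg, ContinuousLinearMap.nonneg_iff_isPositive,
        ContinuousLinearMap.isPositive_def']
      refine ⟨?_, fun k => ?_⟩
      · refine IsSelfAdjoint.sub (IsSelfAdjoint.add ?_ (.mul_star_self _)) ?_
        · exact (IsSelfAdjoint.of_nonneg hN).conjugate _
        · exact IsSelfAdjoint.algebraMap _ (.all _)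
      · have h1 := hNE (star (E : H →L[ℂ] H) k)
        rw [hEstar] at h1
        set x := star (E : H →L[ℂ] H) k with hx
        have h2 : RCLike.re ⟪((E : H →L[ℂ] H) * N * star (E : H →L[ℂ] H)) k, k⟫_ℂ =
            RCLike.re ⟪x, N x⟫_ℂ := by
          rw [inner_re_symm]
          simp only [mul_apply_eq_comp]
          rw [← hx, hx, ContinuousLinearMap.star_eq_adjoint,
            ContinuousLinearMap.adjoint_inner_left]
        have h3 : RCLike.re ⟪((1 - (E : H →L[ℂ] H)) * star (1 - (E : H →L[ℂ] H))) k, k⟫_ℂ =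
            ‖k - x‖ ^ 2 := by
          rw [mul_apply_eq_comp, ← ContinuousLinearMap.adjoint_inner_right,
            ← ContinuousLinearMap.star_eq_adjoint, inner_self_eq_norm_sq]
          simp [hx]
        have h4 : RCLike.re ⟪(algebraMap ℝ (H →L[ℂ] H) c') k, k⟫_ℂ = c' * ‖k‖ ^ 2 := by
          rw [Algebra.algebraMap_eq_smul_one, smul_apply, one_apply_eq_self,
            ← Complex.coe_smul, inner_smul_left, Complex.conj_ofReal]
          exact (RCLike.re_ofReal_mul _ _).trans (congrArg (c' * ·) (inner_self_eq_norm_sq k))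
        have h5 : ‖k‖ ^ 2 ≤ 2 * (‖x‖ ^ 2 + ‖k - x‖ ^ 2) := by
          have : ‖k‖ ≤ ‖x‖ + ‖k - x‖ := by simpa using norm_add_le x (k - x)
          have := norm_nonneg k
          nlinarith [sq_nonneg (‖x‖ - ‖k - x‖)]
        rw [ContinuousLinearMap.reApplyInnerSelf_apply, sub_apply, add_apply, inner_sub_left,
          inner_add_left, map_sub, map_add, h2, h3, h4]
        have h6 : min c 1 ≤ c := min_le_left _ _
        have h7 : min c 1 ≤ 1 := min_le_right _ _
        have h8 : 0 < min c 1 := by positivity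
        rw [hc']
        nlinarith [sq_nonneg ‖x‖, sq_nonneg ‖k - x‖]
    exact hP'
  have hPpos : IsStrictlyPositive P := by
    exact IsStrictlyPositive.of_le (isStrictlyPositive_algebraMap hc'0) hPle
  refine exists_similar_of_isStrictlyPositive φ P hPpos fun a => ?_
  have e1 : φ a * (1 - E) = 0 := by rw [mul_sub, hE', mul_one, sub_self]
  have e2 : star (1 - E) * star (φ (star a)) = 0 := by
    rw [← star_mul, mul_sub, hE', mul_one, sub_self, star_zero]
  have e3 : φ a * N₀ = N₀ * star (φ (star a)) := by
    apply Subtype.ext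
    change (φ a : H →L[ℂ] H) * ((E : H →L[ℂ] H) * N * star (E : H →L[ℂ] H)) =
      ((E : H →L[ℂ] H) * N * star (E : H →L[ℂ] H)) * star (φ (star a) : H →L[ℂ] H)
    have f1 : (φ a : H →L[ℂ] H) * (E : H →L[ℂ] H) = φ a := congrArg Subtype.val (hE' a)
    have f2 : (E : H →L[ℂ] H) * (φ a : H →L[ℂ] H) = φ a := congrArg Subtype.val (hE a)
    have f3 : star (E : H →L[ℂ] H) * star (φ (star a) : H →L[ℂ] H) =
        star (φ (star a) : H →L[ℂ] H) := by
      rw [← star_mul]; exact congrArg star (congrArg Subtype.val (hE' (star a)))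
    have f4 : star (φ (star a) : H →L[ℂ] H) * star (E : H →L[ℂ] H) =
        star (φ (star a) : H →L[ℂ] H) := by
      rw [← star_mul]; exact congrArg star (congrArg Subtype.val (hE (star a)))
    rw [← mul_assoc, ← mul_assoc, f1, hφN, mul_assoc, f4, mul_assoc (_ * N), f3, mul_assoc,
      ← hφN, ← mul_assoc, f2]
  rw [mul_add, add_mul, e3, ← mul_assoc, e1, zero_mul, mul_assoc (1 - E), e2, mul_zero]

end VonNeumannAlgebra

/-! ### Completely positive dilations give similarities -/

namespace VonNeumannAlgebra

open scoped InnerProductSpace ComplexOrder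
open Filter Topology

variable {H : Type*} [NormedAddCommGroup H] [InnerProductSpace ℂ H] [CompleteSpace H]
  {A : Type*} [NonUnitalCStarAlgebra A]

/-- The sesquilinear forms `⟪k, θ(b) h⟫` of a linear map `θ` with values in operators. -/
noncomputable def operatorForm (M : VonNeumannAlgebra H) (θ : A →ₗ[ℂ] M) :
    A →ₗ[ℂ] H →ₗ⋆[ℂ] H →ₗ[ℂ] ℂ where
  toFun b := LinearMap.mk₂'ₛₗ (starRingEnd ℂ) (RingHom.id ℂ)
    (fun k h => ⟪k, (θ b : H →L[ℂ] H) h⟫_ℂ)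
    (by simp) (by simp [mul_comm]) (by simp) (by simp)
  map_add' a b := LinearMap.ext₂ fun k h => by simp
  map_smul' c a := LinearMap.ext₂ fun k h => by
    rw [map_smul]
    exact inner_smul_right _ _ _

@[simp]
theorem operatorForm_apply (M : VonNeumannAlgebra H) (θ : A →ₗ[ℂ] M) (b : A) (k h : H) :
    M.operatorForm θ b k h = ⟪k, (θ b : H →L[ℂ] H) h⟫_ℂ := rfl

/-- The sesquilinear forms of a linear map with values in `2 × 2` matrices of operators. -/
noncomputable def matrixForm (M : VonNeumannAlgebra H)
    (Ψ : A →ₗ[ℂ] CStarMatrix (Fin 2) (Fin 2) M) :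
    A →ₗ[ℂ] (Fin 2 → H) →ₗ⋆[ℂ] (Fin 2 → H) →ₗ[ℂ] ℂ where
  toFun b := LinearMap.mk₂'ₛₗ (starRingEnd ℂ) (RingHom.id ℂ)
    (fun k h => ∑ p, ∑ q, ⟪k p, (Ψ b p q : H →L[ℂ] H) (h q)⟫_ℂ)
    (by intros; simp; abel) (by intros; simp; ring) (by intros; simp; abel)
    (by intros; simp; ring)
  map_add' a b := LinearMap.ext₂ fun k h => by simp; abel
  map_smul' c a := LinearMap.ext₂ fun k h => by
    simp only [map_smul, LinearMap.mk₂'ₛₗ_apply, RingHom.id_apply, LinearMap.smul_apply,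
      smul_eq_mul, Finset.mul_sum]
    exact Finset.sum_congr rfl fun p _ => Finset.sum_congr rfl fun q _ => inner_smul_right _ _ _

@[simp]
theorem matrixForm_apply (M : VonNeumannAlgebra H)
    (Ψ : A →ₗ[ℂ] CStarMatrix (Fin 2) (Fin 2) M) (b : A) (k h : Fin 2 → H) :
    M.matrixForm Ψ b k h = ∑ p, ∑ q, ⟪k p, (Ψ b p q : H →L[ℂ] H) (h q)⟫_ℂ := rfl

variable [PartialOrder A] [StarOrderedRing A]

theorem kernelForm_matrixForm_nonneg (M : VonNeumannAlgebra H)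
    (Ψ : A →CP CStarMatrix (Fin 2) (Fin 2) M) (ξ : A ⊗[ℂ] (Fin 2 → H)) :
    0 ≤ kernelForm (M.matrixForm Ψ.toLinearMap) ξ ξ := by
  refine kernelForm_nonneg _ (fun n b h => ?_) ξ
  obtain ⟨Y, hY⟩ := Ψ.exists_sum_of_family n b
  have := sum_inner_nonneg_of_sum (ι := Fin n × Fin 2) (κ := Fin n × Fin 2)
    (fun k i => (Y k.1 i.1 k.2 i.2 : H →L[ℂ] H))
    (fun i j => (Ψ (star (b i.1) * b j.1) i.2 j.2 : H →L[ℂ] H)) (fun i j => by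
      rw [hY, CStarMatrix.sum_apply, Fintype.sum_prod_type, AddSubmonoidClass.coe_finsetSum]
      refine Finset.sum_congr rfl fun k _ => ?_
      rw [CStarMatrix.mul_apply, AddSubmonoidClass.coe_finsetSum]
      rfl) (fun i => h i.1 i.2)
  simp only [Fintype.sum_prod_type] at this
  refine this.trans_eq (Finset.sum_congr rfl fun i _ => ?_)
  rw [Finset.sum_comm]
  rfl

/-- The form `s` of `φ₁` is the corner of the form `r` of `Ψ`, and the off-diagonal entry of `r` is
`Q`; Cauchy–Schwarz for `r` therefore bounds `Q` by `s`. -/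
theorem exists_similar_of_matrix (M : VonNeumannAlgebra H) (φ : A →ₙₐ[ℂ] M)
    (hφ : ∃ C : ℝ, ∀ a : A, ‖φ a‖ ≤ C * ‖a‖) (φ₁ φ₂ : A →CP M)
    (Ψ : A →CP CStarMatrix (Fin 2) (Fin 2) M)
    (hΨ : ∀ a : A, Ψ a = CStarMatrix.ofMatrix !![φ₁ a, star (φ (star a)); φ a, φ₂ a]) :
    ∃ (S : (↥M)ˣ) (π : A →⋆ₙₐ[ℂ] M), ∀ a : A, π a = (S : M) * φ a * ((S⁻¹ : (↥M)ˣ) : M) := by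
  obtain ⟨E, l, hl0, hl, hE, hE', hEE, hlim⟩ := M.exists_support_idempotent φ hφ
  obtain ⟨C, hC⟩ := hφ
  have hφc : Continuous φ := AddMonoidHomClass.continuous_of_bound (φ : A →+ M) C hC
  obtain ⟨C₁, hC₁0, hC₁⟩ := φ₁.exists_norm_le
  obtain ⟨C₂, hC₂0, hC₂⟩ := φ₂.exists_norm_le
  let s := kernelForm (M.operatorForm φ₁.toLinearMap)
  let r := kernelForm (M.matrixForm Ψ.toLinearMap)
  have hr := M.kernelForm_matrixForm_nonneg Ψ
  have h00 (a : A) : Ψ.toLinearMap a 0 0 = φ₁.toLinearMap a :=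
    congrArg (fun X : CStarMatrix (Fin 2) (Fin 2) M => X 0 0) (hΨ a)
  have h10 (a : A) : Ψ.toLinearMap a 1 0 = φ a :=
    congrArg (fun X : CStarMatrix (Fin 2) (Fin 2) M => X 1 0) (hΨ a)
  have h11 (a : A) : Ψ.toLinearMap a 1 1 = φ₂ a :=
    congrArg (fun X : CStarMatrix (Fin 2) (Fin 2) M => X 1 1) (hΨ a)
  let j := LinearMap.lTensor A (LinearMap.single ℂ (fun _ : Fin 2 => H) 0)
  have hj (ξ η) : r (j ξ) (j η) = s ξ η := by
    refine (kernelForm_lTensor _ (M.operatorForm φ₁.toLinearMap) _ _ LinearMap.id ?_ ξ η).trans ?_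
    · intro b k h
      simp [h00]
    · simp [s]
  have hs (ξ) : 0 ≤ s ξ ξ := by rw [← hj]; exact hr _
  let Q : A ⊗[ℂ] H →ₗ[ℂ] H := TensorProduct.lift <| LinearMap.mk₂ ℂ
    (fun a h => (φ a : H →L[ℂ] H) h) (by simp) (fun c a h => by rw [map_smul]; rfl) (by simp)
    (by simp)
  have hQt (a : A) (h : H) : Q (a ⊗ₜ h) = (φ a : H →L[ℂ] H) h := rfl
  have hQmul (c : A) (ξ) : Q (leftMul H c ξ) = (φ c : H →L[ℂ] H) (Q ξ) := by
    induction ξ using TensorProduct.induction_on with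
    | zero => simp
    | tmul a h => rw [leftMul_tmul, hQt, hQt, map_mul]; rfl
    | add x y hx hy => simp only [map_add, hx, hy]
  have hrQ (e : A) (g : H) (ξ) :
      r (e ⊗ₜ Pi.single 1 g) (j ξ) = ⟪g, Q (leftMul H (star e) ξ)⟫_ℂ := by
    induction ξ using TensorProduct.induction_on with
    | zero => simp
    | tmul a h =>
      simp [r, j, Q, h10]
    | add x y hx hy => simp only [map_add, hx, hy, inner_add_right]
  have norm_inner_self (x : H) : ‖⟪x, x⟫_ℂ‖ = ‖x‖ ^ 2 := by
    rw [inner_self_eq_norm_sq_to_K]; simp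
  have bound (T : M) (c : ℝ) (hT : ‖T‖ ≤ c) (g : H) :
      (⟪g, (T : H →L[ℂ] H) g⟫_ℂ).re ≤ c * ‖g‖ ^ 2 :=
    calc (⟪g, (T : H →L[ℂ] H) g⟫_ℂ).re ≤ ‖g‖ * ‖(T : H →L[ℂ] H) g‖ :=
          (Complex.re_le_norm _).trans (norm_inner_le_norm _ _)
      _ ≤ ‖g‖ * (c * ‖g‖) := by
          gcongr
          exact (T : H →L[ℂ] H).le_of_opNorm_le hT g
      _ = c * ‖g‖ ^ 2 := by ring
  have bound' (f : A →CP M) (c : ℝ) (hc : 0 ≤ c) (hf : ∀ a, ‖f a‖ ≤ c * ‖a‖) (e : A)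
      (he : ‖e‖ ≤ 1) : ‖f (star e * e)‖ ≤ c := by
    refine (hf _).trans (mul_le_of_le_one_right hc ?_)
    rw [CStarRing.norm_star_mul_self]
    exact mul_le_one₀ he (norm_nonneg _) he
  have hrr (e : A) (g : H) (he : ‖e‖ ≤ 1) :
      (r (e ⊗ₜ Pi.single 1 g) (e ⊗ₜ Pi.single 1 g)).re ≤ C₂ * ‖g‖ ^ 2 := by
    have e1 : r (e ⊗ₜ Pi.single 1 g) (e ⊗ₜ Pi.single 1 g) =
        ⟪g, (φ₂ (star e * e) : H →L[ℂ] H) g⟫_ℂ := by simp [r, h11]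
    rw [e1]
    exact bound _ _ (bound' φ₂ C₂ hC₂0 hC₂ e he) g
  have hss (e : A) (g : H) (he : ‖e‖ ≤ 1) : (s (e ⊗ₜ g) (e ⊗ₜ g)).re ≤ C₁ * ‖g‖ ^ 2 :=
    bound _ _ (bound' φ₁ C₁ hC₁0 hC₁ e he) g
  have hQlim (ξ) : Tendsto (fun e => Q (leftMul H e ξ)) l (𝓝 (Q ξ)) := by
    induction ξ using TensorProduct.induction_on with
    | zero => simp
    | tmul a h =>
      have hc : Continuous fun S : M => (S : H →L[ℂ] H) h := by
        have : Continuous fun S : M => (S : H →L[ℂ] H) := continuous_subtype_val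
        fun_prop
      exact ((hc.comp hφc).tendsto a).comp (hl.tendsto_mul_right a)
    | add x y hx hy => simpa using hx.add hy
  -- Cauchy–Schwarz for `r` between `e ⊗ (0, Qξ)` and `(ξ, 0)`, with `e` running through the
  -- approximate unit.
  have hQ (ξ) : ‖Q ξ‖ ^ 2 ≤ C₂ * (s ξ ξ).re := by
    have hs0 : 0 ≤ (s ξ ξ).re := (Complex.nonneg_iff.mp (hs ξ)).1
    have h1 : ‖⟪Q ξ, Q ξ⟫_ℂ‖ ^ 2 ≤ C₂ * ‖Q ξ‖ ^ 2 * (s ξ ξ).re := by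
      refine le_of_tendsto (((tendsto_const_nhds.inner (hQlim ξ)).norm).pow 2) ?_
      filter_upwards [hl.eventually_norm, hl.eventually_star_eq] with e he hes
      have h2 := r.norm_apply_sq_le_of_nonneg hr (e ⊗ₜ Pi.single 1 (Q ξ)) (j ξ)
      rw [hrQ, hes, hj] at h2
      exact h2.trans (mul_le_mul_of_nonneg_right (hrr e (Q ξ) he) hs0)
    rw [norm_inner_self] at h1
    rcases (sq_nonneg ‖Q ξ‖).eq_or_lt with h | h
    · rw [← h]; positivity
    · refine le_of_mul_le_mul_right ?_ h
      calc ‖Q ξ‖ ^ 2 * ‖Q ξ‖ ^ 2 = (‖Q ξ‖ ^ 2) ^ 2 := (sq _).symm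
        _ ≤ _ := h1
        _ = _ := by ring
  obtain ⟨N, hN0, hN1, hN2⟩ := exists_operator_of_form s hs Q C₂ hC₂0 hQ
  have hφN (a : A) : (φ a : H →L[ℂ] H) * N = N * star (φ (star a) : H →L[ℂ] H) :=
    hN1 (leftMul H a) (leftMul H (star a)) (‖a‖ ^ 2) _ _ (by positivity)
      (kernelForm_leftMul_le _ hs a)
      (fun ξ => by simpa using kernelForm_leftMul_le _ hs (star a) ξ)
      (kernelForm_leftMul _ a) (hQmul a) (hQmul (star a))
  -- Unitaries are isometric for `s`, so the boundedness required of `L` holds with constant `1`;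
  -- the rest of `M'` follows since unitaries span it.
  have hu (u : M.commutant) (hu : u ∈ unitary M.commutant) : (u : H →L[ℂ] H) * N =
      N * (u : H →L[ℂ] H) := by
    let L (x : M.commutant) : A ⊗[ℂ] H →ₗ[ℂ] A ⊗[ℂ] H :=
      LinearMap.lTensor A (x : H →L[ℂ] H).toLinearMap
    have hL (x : M.commutant) (ξ η) : s (L x ξ) η = s ξ (L (star x) η) := by
      have := kernelForm_lTensor (M.operatorForm φ₁.toLinearMap)
        (M.operatorForm φ₁.toLinearMap) (x : H →L[ℂ] H).toLinearMap LinearMap.id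
        (star (x : H →L[ℂ] H)).toLinearMap (fun b k h => by
          have hc := M.commute_of_mem (φ₁ b).2 (star_mem x.2)
          have : ((φ₁ b : H →L[ℂ] H) * star (x : H →L[ℂ] H)) h =
            (star (x : H →L[ℂ] H) * (φ₁ b : H →L[ℂ] H)) h := by rw [hc]
          change ⟪(x : H →L[ℂ] H) k, (φ₁ b : H →L[ℂ] H) h⟫_ℂ =
            ⟪k, ((φ₁ b : H →L[ℂ] H) * star (x : H →L[ℂ] H)) h⟫_ℂ
          rw [this, mul_apply_eq_comp, ContinuousLinearMap.star_eq_adjoint,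
            ContinuousLinearMap.adjoint_inner_right]) ξ η
      rwa [LinearMap.lTensor_id] at this
    have hLmul (x y : M.commutant) (h : x * y = 1) (ξ) : L x (L y ξ) = ξ := by
      have h1 : (x : H →L[ℂ] H).toLinearMap ∘ₗ (y : H →L[ℂ] H).toLinearMap = LinearMap.id :=
        LinearMap.ext fun v => congrArg (fun S : M.commutant => (S : H →L[ℂ] H) v) h
      simp only [L, ← LinearMap.comp_apply, ← LinearMap.lTensor_comp, h1, LinearMap.lTensor_id,
        LinearMap.id_apply]
    have hLQ (x : M.commutant) (ξ) : Q (L x ξ) = (x : H →L[ℂ] H) (Q ξ) := by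
      induction ξ using TensorProduct.induction_on with
      | zero => simp
      | tmul a h =>
        exact congrArg (fun S : H →L[ℂ] H => S h) (M.commute_of_mem (φ a).2 x.2).symm
      | add x y hx hy => simp only [map_add, hx, hy]
    have := hN1 (L u) (L (star u)) 1 u (star u : M.commutant) zero_le_one
      (fun ξ => by rw [hL, hLmul _ _ (Unitary.mem_iff.mp hu).1, one_mul])
      (fun ξ => by
        rw [hL, star_star, hLmul _ _ (Unitary.mem_iff.mp hu).2, one_mul])
      (hL u) (hLQ u) (hLQ (star u))
    simpa using this
  have hcomm (x : M.commutant) : (x : H →L[ℂ] H) * N = N * (x : H →L[ℂ] H) := by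
    have hx : x ∈ Submodule.span ℂ (unitary M.commutant : Set M.commutant) := by
      rw [CStarAlgebra.span_unitary]; trivial
    induction hx using Submodule.span_induction with
    | mem u h => exact hu u h
    | zero => simp
    | add x y _ _ hx hy => simp [add_mul, mul_add, hx, hy]
    | smul c x _ hx =>
      change (c • (x : H →L[ℂ] H)) * N = N * (c • (x : H →L[ℂ] H))
      rw [smul_mul_assoc, mul_smul_comm, hx]
  -- The lower bound tests `N` on `e ⊗ E⋆k`, whose form value is at most `C₁‖E⋆k‖²`, while `⟪k, φ(e)
  -- E⋆k⟫ → ‖E⋆k‖²`. The `+ 1` only makes the constant invertible.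
  refine M.exists_similar_of_operator φ E hE hE' hEE l hlim N hN0 (C₁ + 1)⁻¹ (by positivity)
    (fun k => ?_) hφN fun a x hx => by rw [hcomm ⟨x, hx⟩, sub_self, mul_zero]
  set h := star (E : H →L[ℂ] H) k with hh
  have hN0k : 0 ≤ RCLike.re ⟪k, N k⟫_ℂ :=
    ((ContinuousLinearMap.nonneg_iff_isPositive N).mp hN0).re_inner_nonneg_right k
  have h1 : ‖⟪k, (E : H →L[ℂ] H) h⟫_ℂ‖ ^ 2 ≤ (C₁ + 1) * ‖h‖ ^ 2 * RCLike.re ⟪k, N k⟫_ℂ := by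
    refine le_of_tendsto ((hlim k h).norm.pow 2) ?_
    filter_upwards [hl.eventually_norm] with e he
    refine (hN2 k (e ⊗ₜ h)).trans (mul_le_mul_of_nonneg_right ?_ hN0k)
    refine (hss e h he).trans ?_
    gcongr
    linarith
  have h2 : ⟪k, (E : H →L[ℂ] H) h⟫_ℂ = ⟪h, h⟫_ℂ := by
    rw [← ContinuousLinearMap.adjoint_inner_left, ← ContinuousLinearMap.star_eq_adjoint]
  rw [h2, norm_inner_self] at h1
  rw [inv_mul_le_iff₀ (by positivity)]
  rcases (sq_nonneg ‖h‖).eq_or_lt with h0 | h0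
  · rw [← h0]; positivity
  · refine le_of_mul_le_mul_right ?_ h0
    calc ‖h‖ ^ 2 * ‖h‖ ^ 2 = (‖h‖ ^ 2) ^ 2 := (sq _).symm
      _ ≤ _ := h1
      _ = _ := by ring

end VonNeumannAlgebra

/-! ### A Hahn–Banach theorem for systems of linear inequalities -/

/-- A pair `(v, t)` encodes the demand `t ≤ f v`. By `hneg` the first coordinates form a subspace
`W`. The functional `(0, r) ↦ r` is nonnegative on the cone of all `(w, r)` with `(w, -r) ∈ P`, by
`hP`; its M. Riesz extension to `W × ℝ`, restricted to `W` and extended to `V`, is `f`. -/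
theorem exists_linearMap_ge {V : Type*} [AddCommGroup V] [Module ℝ V] (P : Set (V × ℝ))
    (hzero : (0, 0) ∈ P) (hadd : ∀ x ∈ P, ∀ y ∈ P, x + y ∈ P)
    (hsmul : ∀ c : ℝ, 0 ≤ c → ∀ x ∈ P, c • x ∈ P)
    (hneg : ∀ v t, (v, t) ∈ P → ∃ t', (-v, t') ∈ P) (hP : ∀ t, (0, t) ∈ P → t ≤ 0) :
    ∃ f : V →ₗ[ℝ] ℝ, ∀ v t, (v, t) ∈ P → t ≤ f v := by
  let W : Submodule ℝ V :=
    { carrier := {v | ∃ t, (v, t) ∈ P}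
      zero_mem' := ⟨0, hzero⟩
      add_mem' := fun ⟨t, ht⟩ ⟨u, hu⟩ => ⟨t + u, hadd _ ht _ hu⟩
      smul_mem' := fun c v ⟨t, ht⟩ => by
        rcases le_total 0 c with hc | hc
        · exact ⟨_, hsmul c hc _ ht⟩
        · obtain ⟨u, hu⟩ := hneg v t ht
          refine ⟨_, (?_ : (_, -c * u) ∈ P)⟩
          have := hsmul (-c) (neg_nonneg.mpr hc) _ hu
          simpa using this }
  let s : PointedCone ℝ (W × ℝ) :=
    { carrier := {x | ((x.1 : V), -x.2) ∈ P}
      zero_mem' := by simpa using hzero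
      add_mem' := fun {x y} hx hy => by
        have := hadd _ hx _ hy
        simp only [Prod.mk_add_mk] at this
        simpa [add_comm] using this
      smul_mem' := fun c x hx => by
        have := hsmul c c.2 _ hx
        simpa using this }
  let f : (W × ℝ) →ₗ.[ℝ] ℝ :=
    { domain := (⊥ : Submodule ℝ W).prod ⊤
      toFun := LinearMap.snd ℝ W ℝ ∘ₗ Submodule.subtype _ }
  obtain ⟨g, hg, hgs⟩ := riesz_extension s f (fun ⟨⟨w, r⟩, hx⟩ hxs => by
      obtain rfl : w = 0 := hx.1
      have := hP _ (show ((0 : V), -r) ∈ P from hxs)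
      change 0 ≤ r
      linarith) (fun ⟨⟨w, t, ht⟩, r⟩ => by
      refine ⟨⟨(0, -t - r), ⟨rfl, trivial⟩⟩, ?_⟩
      change ((0 : V) + w, -(-t - r + r)) ∈ P
      simpa using ht)
  obtain ⟨F, hF⟩ := LinearMap.exists_extend (g ∘ₗ LinearMap.inl ℝ W ℝ)
  refine ⟨F, fun v t hvt => ?_⟩
  have h1 : F v = g (⟨v, t, hvt⟩, 0) := LinearMap.congr_fun hF ⟨v, t, hvt⟩
  have h2 : 0 ≤ g (⟨v, t, hvt⟩, -t) := hgs _ (show (v, - -t) ∈ P by rwa [neg_neg])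
  have h3 : g (0, -t) = -t := hg ⟨(0, -t), ⟨rfl, trivial⟩⟩
  have h4 : ((⟨v, t, hvt⟩, -t) : W × ℝ) = (⟨v, t, hvt⟩, 0) + (0, -t) := by simp
  rw [h4, map_add, h3] at h2
  linarith

/-! ### Unital completely bounded representations: the intertwining operator -/

section CompletelyBounded

open scoped InnerProductSpace ComplexOrder

variable {H : Type*} [NormedAddCommGroup H] [InnerProductSpace ℂ H]

/-- Finitely many vectors and tensors can be expanded in an orthonormal family that diagonalizes
the positive operator `∑ l, |h l⟩⟨h l|`. -/
theorem exists_diagonalizing_orthonormal {D κ ι : Type*} [AddCommGroup D] [Module ℂ D] [Finite κ]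
    [Fintype ι] (ξ : κ → D ⊗[ℂ] H) (h : ι → H) :
    ∃ (N : ℕ) (e : Fin N → H) (μ : Fin N → ℝ) (b : κ → Fin N → D), Orthonormal ℂ e ∧
      (∀ k, ξ k = ∑ j, b k j ⊗ₜ e j) ∧
      (∀ i j, ∑ l, ⟪e j, h l⟫_ℂ * ⟪h l, e i⟫_ℂ = if i = j then (μ i : ℂ) else 0) ∧
      (∀ i, 0 ≤ μ i) ∧ ∑ i, μ i = ∑ l, ‖h l‖ ^ 2 := by
  choose n b g hbg using fun k => exists_sum_tmul (ξ k)
  let S : Submodule ℂ H :=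
    Submodule.span ℂ (Set.range (fun x : (Σ k, Fin (n k)) => g x.1 x.2) ∪ Set.range h)
  have : FiniteDimensional ℂ S :=
    FiniteDimensional.span_of_finite ℂ ((Set.finite_range _).union (Set.finite_range _))
  have hg (k i) : g k i ∈ S := Submodule.subset_span (Or.inl ⟨⟨k, i⟩, rfl⟩)
  have hh (l) : h l ∈ S := Submodule.subset_span (Or.inr ⟨l, rfl⟩)
  let h' (l : ι) : S := ⟨h l, hh l⟩
  -- An eigenbasis of `ρ` serves as `e`, its eigenvalues as `μ`; their sum is the trace of `ρ`.
  let ρ : S →ₗ[ℂ] S := ∑ l, (InnerProductSpace.rankOne ℂ (h' l) (h' l)).toLinearMap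
  have hρ (x : S) : ρ x = ∑ l, ⟪h' l, x⟫_ℂ • h' l := by simp [ρ, LinearMap.sum_apply]
  have hsym : ρ.IsSymmetric := fun x y => by
    simp [hρ, sum_inner, inner_sum, inner_smul_left, inner_smul_right, mul_comm]
  let e := hsym.eigenvectorBasis rfl
  let μ := hsym.eigenvalues rfl
  have key (i j) :
      ∑ l, ⟪(e j : H), h l⟫_ℂ * ⟪h l, (e i : H)⟫_ℂ = if i = j then (μ i : ℂ) else 0 := by
    have h1 : ⟪e j, ρ (e i)⟫_ℂ = if i = j then (μ i : ℂ) else 0 := by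
      rw [hsym.apply_eigenvectorBasis, inner_smul_right]
      have := orthonormal_iff_ite.mp e.orthonormal j i
      rw [this]
      by_cases hij : i = j
      · simp [hij]; rfl
      · simp [hij, Ne.symm hij]
    rw [← h1, hρ, inner_sum]
    refine Finset.sum_congr rfl fun l _ => ?_
    rw [inner_smul_right, mul_comm]
    rfl
  have hμ (i) : μ i = ∑ l, ‖⟪e i, h' l⟫_ℂ‖ ^ 2 := by
    have h1 := key i i
    rw [if_pos rfl] at h1
    apply Complex.ofReal_injective
    rw [← h1]
    push_cast
    refine Finset.sum_congr rfl fun l _ => ?_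
    rw [← inner_conj_symm (h l) (e i : H)]
    exact RCLike.mul_conj _
  refine ⟨_, fun j => (e j : H), μ, fun k j => ∑ i, ⟪e j, (⟨g k i, hg k i⟩ : S)⟫_ℂ • b k i,
    e.orthonormal.comp_linearIsometry S.subtypeₗᵢ, fun k => ?_, key, fun i => ?_, ?_⟩
  · rw [hbg]
    simp only [TensorProduct.sum_tmul]
    rw [Finset.sum_comm]
    refine Finset.sum_congr rfl fun i _ => ?_
    simp only [TensorProduct.smul_tmul, ← TensorProduct.tmul_sum]
    congr 1
    have := congrArg S.subtype (e.sum_repr' ⟨g k i, hg k i⟩)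
    simpa using this.symm
  · rw [hμ]; positivity
  · simp only [hμ]
    rw [Finset.sum_comm]
    refine Finset.sum_congr rfl fun l _ => ?_
    rw [e.sum_sq_norm_inner_right]
    rfl

variable {D : Type*} [CStarAlgebra D]

/-- The kernel `(b, k, h) ↦ b ⊗ |h⟩⟨k|`. -/
noncomputable def rankOneKernel (D H : Type*) [CStarAlgebra D] [NormedAddCommGroup H]
    [InnerProductSpace ℂ H] : D →ₗ[ℂ] H →ₗ⋆[ℂ] H →ₗ[ℂ] D ⊗[ℂ] (H →L[ℂ] H) where
  toFun b := LinearMap.mk₂'ₛₗ (starRingEnd ℂ) (RingHom.id ℂ)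
    (fun k h => b ⊗ₜ InnerProductSpace.rankOne ℂ h k)
    (by simp [TensorProduct.tmul_add]) (by simp) (by simp [TensorProduct.tmul_add]) (by simp)
  map_add' a b := LinearMap.ext₂ fun k h => by simp [TensorProduct.add_tmul]
  map_smul' c a := LinearMap.ext₂ fun k h => by simp [TensorProduct.smul_tmul']

@[simp]
theorem rankOneKernel_apply (b : D) (k h : H) :
    rankOneKernel D H b k h = b ⊗ₜ InnerProductSpace.rankOne ℂ h k := rfl

/-- The evaluation `b ⊗ h ↦ Φ(b) h`. -/
noncomputable def evalTensor (Φ : D →ₗ[ℂ] (H →L[ℂ] H)) : D ⊗[ℂ] H →ₗ[ℂ] H :=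
  TensorProduct.lift <| LinearMap.mk₂ ℂ (fun a h => Φ a h) (by simp) (by simp) (by simp) (by simp)

@[simp]
theorem evalTensor_tmul (Φ : D →ₗ[ℂ] (H →L[ℂ] H)) (a : D) (h : H) :
    evalTensor Φ (a ⊗ₜ h) = Φ a h := rfl

variable [CompleteSpace H]

theorem norm_map_le_of_fintype {A B : Type*} [NonUnitalCStarAlgebra A] [PartialOrder A]
    [StarOrderedRing A] [NonUnitalCStarAlgebra B] [PartialOrder B] [StarOrderedRing B]
    (f : A →ₗ[ℂ] B) (C : ℝ)
    (hf : ∀ (n : ℕ) (X : CStarMatrix (Fin n) (Fin n) A), ‖X.map f‖ ≤ C * ‖X‖)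
    {n : Type*} [Fintype n] (X : CStarMatrix n n A) : ‖X.map f‖ ≤ C * ‖X‖ := by
  let e := Fintype.equivFin n
  have h1 := hf _ (CStarMatrix.reindexₐ ℂ A e X)
  have h2 : (CStarMatrix.reindexₐ ℂ A e X).map f = CStarMatrix.reindexₐ ℂ B e (X.map f) :=
    (CStarMatrix.mapₗ_reindexₐ f).symm
  rw [h2, StarAlgEquiv.norm_map, StarAlgEquiv.norm_map] at h1
  exact h1

/-- Such an `x` is a partial isometry: the C⋆-identity used twice gives `‖x‖⁴ = ‖x‖²`. -/
theorem norm_le_one_of_isIdempotentElem {A : Type*} [NonUnitalCStarAlgebra A] (x : A)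
    (h : (star x * x) * (star x * x) = star x * x) : ‖x‖ ≤ 1 := by
  have h1 := CStarRing.norm_star_mul_self (x := star x * x)
  rw [star_mul, star_star, h, CStarRing.norm_star_mul_self] at h1
  by_contra! hx
  have : ‖x‖ * ‖x‖ > 1 := by nlinarith
  nlinarith

/-- This is where complete boundedness enters. In the diagonalizing basis the hypothesis reads `∑ₖ
bₖᵢ⋆ bₖⱼ = δᵢⱼ μᵢ`, so the rescaled coefficients `dₖⱼ` form a partial isometry. Its image under `Φ`
has norm at most `C`, and it sends the vector with entries `√μⱼ eⱼ` to the family `Q(ξₖ)`. -/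
theorem sum_norm_evalTensor_sq_le [PartialOrder D] [StarOrderedRing D]
    (Φ : D →ₗ[ℂ] (H →L[ℂ] H)) (C : ℝ) (hC : 0 ≤ C)
    (hΦ : ∀ (n : ℕ) (X : CStarMatrix (Fin n) (Fin n) D), ‖X.map Φ‖ ≤ C * ‖X‖)
    {κ ι : Type} [Fintype κ] [Fintype ι] (ξ : κ → D ⊗[ℂ] H) (h : ι → H)
    (heq : ∑ k, kernelForm (rankOneKernel D H) (ξ k) (ξ k) =
      ∑ l, kernelForm (rankOneKernel D H) (1 ⊗ₜ h l) (1 ⊗ₜ h l)) :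
    ∑ k, ‖evalTensor Φ (ξ k)‖ ^ 2 ≤ C ^ 2 * ∑ l, ‖h l‖ ^ 2 := by
  classical
  obtain ⟨N, e, μ, b, he, hξ, hμ, hμ0, hμh⟩ := exists_diagonalizing_orthonormal ξ h
  have hb (i j) : ∑ k, star (b k i) * b k j = if i = j then (μ i : ℂ) • (1 : D) else 0 := by
    let ω : D ⊗[ℂ] (H →L[ℂ] H) →ₗ[ℂ] D := TensorProduct.lift <| LinearMap.mk₂ ℂ
      (fun a T => ⟪e j, T (e i)⟫_ℂ • a) (by simp) (fun c a T => smul_comm _ _ _)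
      (by simp [add_smul]) (by simp [mul_smul])
    have hω (a T) : ω (a ⊗ₜ T) = ⟪e j, T (e i)⟫_ℂ • a := rfl
    have h1 := congrArg ω heq
    have h2 (k) : ω (kernelForm (rankOneKernel D H) (ξ k) (ξ k)) = star (b k i) * b k j := by
      rw [hξ k]
      simp only [map_sum, LinearMap.sum_apply, kernelForm_tmul, rankOneKernel_apply, hω,
        InnerProductSpace.rankOne_apply, inner_smul_right, orthonormal_iff_ite.mp he]
      simp
    simp only [map_sum, h2] at h1
    rw [h1]
    simp only [kernelForm_tmul, rankOneKernel_apply, hω, InnerProductSpace.rankOne_apply,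
      inner_smul_right, star_one, one_mul, ← Finset.sum_smul]
    rw [Finset.sum_congr rfl fun l (_ : l ∈ Finset.univ) => mul_comm ⟪h l, e i⟫_ℂ ⟪e j, h l⟫_ℂ,
      hμ, ite_smul, zero_smul]
  have hb0 (k i) (hi : μ i = 0) : b k i = 0 := by
    have h1 := hb i i
    rw [if_pos rfl, hi, Complex.ofReal_zero, zero_smul] at h1
    have h2 := (Finset.sum_eq_zero_iff_of_nonneg fun k _ => star_mul_self_nonneg (b k i)).mp h1 k
      (Finset.mem_univ k)
    exact CStarRing.star_mul_self_eq_zero_iff _ |>.mp h2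
  -- For `μ j = 0` the convention `0⁻¹ = 0` gives `d k j = 0`, which loses nothing because `b k j`
  -- vanishes too.
  let d (k : κ) (j : Fin N) : D := (((√(μ j))⁻¹ : ℝ) : ℂ) • b k j
  have hd (k j) : b k j = ((√(μ j) : ℝ) : ℂ) • d k j := by
    by_cases hj : μ j = 0
    · rw [hb0 k j hj]; simp [d, hb0 k j hj]
    · have : √(μ j) ≠ 0 := (Real.sqrt_ne_zero (hμ0 j)).mpr hj
      rw [smul_smul, ← Complex.ofReal_mul, mul_inv_cancel₀ this, Complex.ofReal_one, one_smul]
  have hdd (i j) : ∑ k, star (d k i) * d k j = if i = j ∧ μ i ≠ 0 then (1 : D) else 0 := by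
    have h1 (k) : star (d k i) * d k j =
        ((((√(μ i))⁻¹ * (√(μ j))⁻¹ : ℝ)) : ℂ) • (star (b k i) * b k j) := by
      simp only [d, star_smul, smul_mul_smul_comm]
      simp
    simp only [h1, ← Finset.smul_sum, hb]
    by_cases hij : i = j
    · subst hij
      by_cases hi : μ i = 0
      · simp [hi]
      · rw [if_pos rfl, if_pos ⟨rfl, hi⟩, smul_smul, ← Complex.ofReal_mul, ← mul_inv,
          Real.mul_self_sqrt (hμ0 i), inv_mul_cancel₀ hi, Complex.ofReal_one, one_smul]
    · simp [hij]
  -- The rectangular matrix `d` is padded by zeros, as complete boundedness speaks of square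
  -- matrices only.
  let X : CStarMatrix (κ ⊕ Fin N) (κ ⊕ Fin N) D :=
    CStarMatrix.ofMatrix (Matrix.fromBlocks 0 (Matrix.of d) 0 0)
  have hX : ‖X‖ ≤ 1 := by
    apply norm_le_one_of_isIdempotentElem
    have hXX : star X * X = CStarMatrix.ofMatrix (Matrix.fromBlocks 0 0 0
        (Matrix.diagonal fun i => if μ i ≠ 0 then (1 : D) else 0)) := by
      ext p q
      rw [CStarMatrix.mul_apply]
      simp only [CStarMatrix.star_apply, Fintype.sum_sum_type]
      rcases p with p | p <;> rcases q with q | q <;> simp [X]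
      rw [hdd]
      by_cases hpq : p = q
      · subst hpq; simp
      · simp [hpq]
    rw [hXX]
    ext p q
    rw [CStarMatrix.mul_apply]
    simp only [Fintype.sum_sum_type]
    rcases p with p | p <;> rcases q with q | q <;> simp [Matrix.diagonal_apply]
    grind
  obtain ⟨v, hv⟩ : ∃ v : Fin N → H, ∀ j, v j = ((√(μ j) : ℝ) : ℂ) • e j := ⟨_, fun _ => rfl⟩
  have h1 := CStarMatrix.sum_norm_sq_le (X.map Φ) (Sum.elim (0 : κ → H) v)
  have h2 : ‖X.map Φ‖ ≤ C :=
    (norm_map_le_of_fintype Φ C hΦ X).trans (mul_le_of_le_one_right hC hX)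
  have h3 (j : Fin N) : ‖v j‖ ^ 2 = μ j := by
    rw [hv, norm_smul, he.1 j, mul_one, Complex.norm_real, Real.norm_eq_abs, sq_abs,
      Real.sq_sqrt (hμ0 j)]
  have h4 (k : κ) : evalTensor Φ (ξ k) = ∑ j, Φ (d k j) (v j) := by
    rw [hξ k, map_sum]
    refine Finset.sum_congr rfl fun j _ => ?_
    rw [evalTensor_tmul, hd k j, hv]
    simp
  simp [Fintype.sum_sum_type, X, h3, ← h4, hμh] at h1
  refine h1.trans ?_
  gcongr

/-- A unital completely bounded representation `Φ` of a unital C⋆-algebra on a Hilbert space is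
similar to a ⋆-representation: there is a positive operator `N`, bounded below, that intertwines
`b ↦ Φ(b⋆)⋆` and `Φ`. -/
theorem exists_operator_of_completelyBounded [PartialOrder D] [StarOrderedRing D]
    (Φ : D →ₐ[ℂ] (H →L[ℂ] H)) (C : ℝ) (hC : 0 ≤ C)
    (hΦ : ∀ (n : ℕ) (X : CStarMatrix (Fin n) (Fin n) D), ‖X.map Φ‖ ≤ C * ‖X‖) :
    ∃ N : H →L[ℂ] H, 0 ≤ N ∧ (∀ b, Φ b * N = N * star (Φ (star b))) ∧
      ∀ k, ‖k‖ ^ 2 ≤ (C ^ 2 + 1) * RCLike.re ⟪k, N k⟫_ℂ := by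
  let β := kernelForm (rankOneKernel D H)
  let Q := evalTensor Φ.toLinearMap
  -- The wanted functional satisfies `‖Qξ‖² ≤ f(β(ξ, ξ))` and `f(β(1 ⊗ h, 1 ⊗ h)) ≤ C²‖h‖²`; `P` is
  -- the cone of all consequences of these inequalities.
  let P : Set ((D ⊗[ℂ] (H →L[ℂ] H)) × ℝ) := {x | ∃ (κ ι : Type) (_ : Fintype κ) (_ : Fintype ι)
    (ξ : κ → D ⊗[ℂ] H) (h : ι → H),
    x.1 = ∑ k, β (ξ k) (ξ k) - ∑ l, β (1 ⊗ₜ h l) (1 ⊗ₜ h l) ∧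
    x.2 ≤ ∑ k, ‖Q (ξ k)‖ ^ 2 - C ^ 2 * ∑ l, ‖h l‖ ^ 2}
  have hadd : ∀ x ∈ P, ∀ y ∈ P, x + y ∈ P := by
    rintro x ⟨κ, ι, _, _, ξ, h, hx, hx'⟩ y ⟨κ', ι', _, _, ξ', h', hy, hy'⟩
    refine ⟨κ ⊕ κ', ι ⊕ ι', inferInstance, inferInstance, Sum.elim ξ ξ', Sum.elim h h', ?_, ?_⟩
    · simp only [Prod.fst_add, hx, hy, Fintype.sum_sum_type, Sum.elim_inl, Sum.elim_inr]
      abel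
    · simp only [Prod.snd_add, Fintype.sum_sum_type, Sum.elim_inl, Sum.elim_inr]
      linarith
  have hβ (c : ℝ) (hc : 0 ≤ c) (ξ) : β (((√c : ℝ) : ℂ) • ξ) (((√c : ℝ) : ℂ) • ξ) = c • β ξ ξ := by
    simp only [map_smulₛₗ, LinearMap.smul_apply, Complex.conj_ofReal, smul_smul,
      ← Complex.ofReal_mul, Real.mul_self_sqrt hc, RingHom.id_apply]
    exact Complex.coe_smul _ _
  have hsqrt (c : ℝ) (hc : 0 ≤ c) (x : H) : ‖((√c : ℝ) : ℂ) • x‖ ^ 2 = c * ‖x‖ ^ 2 := by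
    rw [norm_smul, mul_pow, Complex.norm_real, Real.norm_eq_abs, sq_abs, Real.sq_sqrt hc]
  have hsmul : ∀ c : ℝ, 0 ≤ c → ∀ x ∈ P, c • x ∈ P := by
    rintro c hc x ⟨κ, ι, _, _, ξ, h, hx, hx'⟩
    refine ⟨κ, ι, inferInstance, inferInstance, fun k => ((√c : ℝ) : ℂ) • ξ k,
      fun l => ((√c : ℝ) : ℂ) • h l, ?_, ?_⟩
    · simp only [TensorProduct.tmul_smul, hβ c hc, Prod.smul_fst, hx, smul_sub, Finset.smul_sum]
    · simp only [map_smul, hsqrt c hc, ← Finset.mul_sum, Prod.smul_snd, smul_eq_mul]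
      nlinarith
  have hpos (ξ) : (β ξ ξ, ‖Q ξ‖ ^ 2) ∈ P :=
    ⟨Unit, Empty, inferInstance, inferInstance, fun _ => ξ, Empty.elim, by simp, by simp⟩
  have hone (h : H) : (-β (1 ⊗ₜ h) (1 ⊗ₜ h), -(C ^ 2 * ‖h‖ ^ 2)) ∈ P :=
    ⟨Empty, Unit, inferInstance, inferInstance, Empty.elim, fun _ => h, by simp, by simp⟩
  have hzero : (0, 0) ∈ P :=
    ⟨Empty, Empty, inferInstance, inferInstance, Empty.elim, Empty.elim, by simp, by simp⟩
  have hsnd {x v} (hx : x ∈ P) (hv : x.1 = v) : ∃ t, (v, t) ∈ P := ⟨x.2, hv ▸ hx⟩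
  -- Upper bounds for `f(β(ξ, ξ))`: elementary tensors use `b⋆b ≤ ‖b‖²`, sums use the parallelogram
  -- law.
  have hnegβ (ξ) : ∃ t, (-β ξ ξ, t) ∈ P := by
    induction ξ using TensorProduct.induction_on with
    | zero => exact ⟨0, by simpa using hzero⟩
    | tmul b h =>
      obtain ⟨c, hc⟩ := exists_star_mul_self_of_nonneg (norm_smul_one_sub_star_mul_self_nonneg b)
      have h1 := hadd _ (hpos (c ⊗ₜ h)) _ (hsmul (‖b‖ ^ 2) (by positivity) _ (hone h))
      refine hsnd h1 ?_
      simp only [Prod.fst_add, Prod.smul_fst, β, kernelForm_tmul, rankOneKernel_apply, ← hc,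
        TensorProduct.sub_tmul, ← TensorProduct.smul_tmul', Complex.coe_smul, star_one, one_mul,
        smul_neg]
      abel
    | add ξ η hξ hη =>
      obtain ⟨t, ht⟩ := hξ
      obtain ⟨u, hu⟩ := hη
      have h1 := hadd _ (hpos (ξ - η)) _ (hadd _ (hsmul 2 zero_le_two _ ht) _
        (hsmul 2 zero_le_two _ hu))
      refine hsnd h1 ?_
      simp [two_smul]
      abel
  have hneg : ∀ v t, (v, t) ∈ P → ∃ t', (-v, t') ∈ P := by
    rintro v t ⟨κ, ι, _, _, ξ, h, hx, -⟩
    choose u hu using fun k => hnegβ (ξ k)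
    have hsum {α : Type} (s : Finset α) (g : α → (D ⊗[ℂ] (H →L[ℂ] H)) × ℝ) (hg : ∀ a, g a ∈ P) :
        ∑ a ∈ s, g a ∈ P := by
      classical
      induction s using Finset.induction_on with
      | empty => exact hzero
      | insert a s ha ih => rw [Finset.sum_insert ha]; exact hadd _ (hg a) _ ih
    have h1 := hadd _ (hsum Finset.univ _ hu) _ (hsum Finset.univ _ fun l => hpos (1 ⊗ₜ h l))
    refine hsnd h1 ?_
    simp only at hx
    simp [hx, Prod.fst_sum, sub_eq_add_neg, add_comm]
  have hle : ∀ t, (0, t) ∈ P → t ≤ 0 := by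
    rintro t ⟨κ, ι, _, _, ξ, h, hx, hx'⟩
    have := sum_norm_evalTensor_sq_le Φ.toLinearMap C hC hΦ ξ h (sub_eq_zero.mp hx.symm)
    simp only [Q] at hx'
    linarith
  obtain ⟨f, hf⟩ := exists_linearMap_ge P hzero hadd hsmul hneg hle
  let F : Module.Dual ℂ (D ⊗[ℂ] (H →L[ℂ] H)) := Module.Dual.extendRCLike (𝕜 := ℂ) f
  have hFre (v) : (F v).re = f v := Module.Dual.re_extendRCLike_apply (𝕜 := ℂ) f v
  -- Only the real part `f` of `F` is controlled, so the form is made Hermitian; its diagonal is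
  -- then exactly `f(β(ξ, ξ))`.
  let t : D →ₗ[ℂ] H →ₗ⋆[ℂ] H →ₗ[ℂ] ℂ :=
    { toFun := fun b => LinearMap.mk₂'ₛₗ (starRingEnd ℂ) (RingHom.id ℂ)
        (fun k h => (F (rankOneKernel D H b k h) +
          starRingEnd ℂ (F (rankOneKernel D H (star b) h k))) / 2)
        (by intros; simp only [map_add, LinearMap.add_apply]; ring)
        (by intros; simp only [map_smulₛₗ, LinearMap.smul_apply, RingHom.id_apply,
              smul_eq_mul, map_mul]; ring)
        (by intros; simp only [map_add, LinearMap.add_apply]; ring)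
        (by intros; simp only [map_smulₛₗ, LinearMap.smul_apply, RingHom.id_apply,
              smul_eq_mul, map_mul, Complex.conj_conj]; ring)
      map_add' := fun a b => LinearMap.ext₂ fun k h => by
        simp only [star_add, map_add, LinearMap.add_apply, LinearMap.mk₂'ₛₗ_apply]; ring
      map_smul' := fun c a => LinearMap.ext₂ fun k h => by
        simp only [star_smul, map_smul, LinearMap.smul_apply, LinearMap.mk₂'ₛₗ_apply,
          RingHom.id_apply, smul_eq_mul, map_mul, RCLike.star_def, Complex.conj_conj]; ring }
  have ht (b k h) : t b k h = (F (rankOneKernel D H b k h) +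
      starRingEnd ℂ (F (rankOneKernel D H (star b) h k))) / 2 := rfl
  have hs_eq (ξ η) : kernelForm t ξ η = (F (β ξ η) + starRingEnd ℂ (F (β η ξ))) / 2 := by
    induction ξ using TensorProduct.induction_on with
    | zero => simp
    | add x y hx hy => simp only [map_add, LinearMap.add_apply, hx, hy]; ring
    | tmul b k =>
      induction η using TensorProduct.induction_on with
      | zero => simp
      | add x y hx hy => simp only [map_add, LinearMap.add_apply, hx, hy]; ring
      | tmul a h => simp only [kernelForm_tmul, ht, β, star_mul, star_star]
  have hs_re (ξ) : kernelForm t ξ ξ = (f (β ξ ξ) : ℂ) := by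
    rw [hs_eq, Complex.add_conj, hFre]
    push_cast
    ring
  have hs (ξ) : 0 ≤ kernelForm t ξ ξ := by
    rw [hs_re, Complex.zero_le_real]
    exact (sq_nonneg _).trans (hf _ _ (hpos ξ))
  obtain ⟨N, hN0, hN1, hN2⟩ := exists_operator_of_form (kernelForm t) hs Q 1 zero_le_one fun ξ => by
    rw [hs_re, Complex.ofReal_re, one_mul]
    exact hf _ _ (hpos ξ)
  have hQmul (b : D) (ξ) : Q (leftMul H b ξ) = Φ b (Q ξ) := by
    induction ξ using TensorProduct.induction_on with
    | zero => simp
    | tmul a h => simp [Q]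
    | add x y hx hy => simp only [map_add, hx, hy]
  refine ⟨N, hN0, fun b => ?_, fun k => ?_⟩
  · exact hN1 (leftMul H b) (leftMul H (star b)) (‖b‖ ^ 2) _ _ (by positivity)
      (kernelForm_leftMul_le _ hs b)
      (fun ξ => by simpa using kernelForm_leftMul_le _ hs (star b) ξ)
      (kernelForm_leftMul _ b) (hQmul b) (hQmul (star b))
  · have hNk : 0 ≤ RCLike.re ⟪k, N k⟫_ℂ :=
      ((ContinuousLinearMap.nonneg_iff_isPositive N).mp hN0).re_inner_nonneg_right k
    -- Unitality gives `Q(1 ⊗ k) = k`, and the form there is at most `C²‖k‖²`.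
    have h1 := hN2 k (1 ⊗ₜ k)
    have h2 : Q (1 ⊗ₜ k) = k := by simp [Q]
    have h3 := hf _ _ (hone k)
    rw [h2, hs_re, Complex.ofReal_re, inner_self_eq_norm_sq_to_K] at h1
    rw [map_neg] at h3
    simp only [norm_pow, RCLike.norm_ofReal, abs_norm] at h1
    rcases (sq_nonneg ‖k‖).eq_or_lt with h0 | h0
    · rw [← h0]; positivity
    · refine le_of_mul_le_mul_right ?_ h0
      calc ‖k‖ ^ 2 * ‖k‖ ^ 2 = (‖k‖ ^ 2) ^ 2 := (sq _).symm
        _ ≤ f (β (1 ⊗ₜ k) (1 ⊗ₜ k)) * RCLike.re ⟪k, N k⟫_ℂ := h1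
        _ ≤ ((C ^ 2 + 1) * ‖k‖ ^ 2) * RCLike.re ⟪k, N k⟫_ℂ := by gcongr; linarith
        _ = _ := by ring

end CompletelyBounded

/-! ### From a completely bounded extension to a similarity -/

section CompletelyBounded

open scoped InnerProductSpace

/-- The unital extension of a completely bounded homomorphism to the unitization is completely
bounded. -/
theorem exists_norm_unitization_lift_map_le {B D : Type*} [NonUnitalCStarAlgebra B]
    [PartialOrder B] [StarOrderedRing B] [CStarAlgebra D] [PartialOrder D] [StarOrderedRing D]
    [PartialOrder (Unitization ℂ B)] [StarOrderedRing (Unitization ℂ B)]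
    (Φ : B →ₙₐ[ℂ] D) (hΦ : IsCompletelyBounded (Φ : B →ₗ[ℂ] D)) :
    ∃ C : ℝ, 0 ≤ C ∧ ∀ (n : ℕ) (X : CStarMatrix (Fin n) (Fin n) (Unitization ℂ B)),
      ‖X.map (Unitization.lift Φ)‖ ≤ C * ‖X‖ := by
  obtain ⟨C, hC⟩ := hΦ
  refine ⟨|C| * 2 + 1, by positivity, fun n X => ?_⟩
  -- The scalar part is a ⋆-homomorphism, hence contractive on matrices; removing it costs the
  -- factor `2`, and its image in `D` the summand `1`.
  let g : Unitization ℂ B →⋆ₙₐ[ℂ] Unitization ℂ B :=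
    (Unitization.starLift (0 : B →⋆ₙₐ[ℂ] Unitization ℂ B)).toNonUnitalStarAlgHom
  let g' : Unitization ℂ B →⋆ₙₐ[ℂ] D :=
    (Unitization.starLift (0 : B →⋆ₙₐ[ℂ] D)).toNonUnitalStarAlgHom
  have hg (x) : g x = algebraMap ℂ _ x.fst := by
    change algebraMap ℂ (Unitization ℂ B) x.fst + 0 = _; rw [add_zero]
  have hg' (x) : g' x = algebraMap ℂ _ x.fst := by
    change algebraMap ℂ D x.fst + 0 = _; rw [add_zero]
  let Y : CStarMatrix (Fin n) (Fin n) B := X.map fun x => x.snd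
  have h1 : X.map (Unitization.lift Φ) = Y.map (Φ : B →ₗ[ℂ] D) + CStarMatrix.mapₙₐ g' X := by
    ext i j
    change algebraMap ℂ D (X i j).fst + Φ (X i j).snd = Φ (X i j).snd + g' (X i j)
    rw [hg', add_comm]
  have h2 : CStarMatrix.mapₙₐ (Unitization.inrNonUnitalStarAlgHom ℂ B) Y =
      X - CStarMatrix.mapₙₐ g X := by
    refine CStarMatrix.ext fun i j => ?_
    change ((X i j).snd : Unitization ℂ B) = X i j - g (X i j)
    rw [hg, eq_sub_iff_add_eq, add_comm]
    exact Unitization.inl_fst_add_inr_snd_eq _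
  have h3 : ‖Y‖ ≤ 2 * ‖X‖ := by
    rw [← NonUnitalStarAlgHom.norm_map
      (CStarMatrix.mapₙₐ (n := Fin n) (Unitization.inrNonUnitalStarAlgHom ℂ B))
      (CStarMatrix.map_injective Unitization.inr_injective) Y, h2, two_mul]
    exact (norm_sub_le _ _).trans
      (add_le_add_right (NonUnitalStarAlgHom.norm_apply_le (CStarMatrix.mapₙₐ g) X) _)
  calc ‖X.map (Unitization.lift Φ)‖ ≤ ‖Y.map (Φ : B →ₗ[ℂ] D)‖ + ‖CStarMatrix.mapₙₐ g' X‖ := by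
        rw [h1]; exact norm_add_le _ _
    _ ≤ |C| * (2 * ‖X‖) + ‖X‖ := by
        refine add_le_add ((hC n Y).trans ?_)
          (NonUnitalStarAlgHom.norm_apply_le (CStarMatrix.mapₙₐ g') X)
        exact mul_le_mul (le_abs_self C) h3 (norm_nonneg Y) (abs_nonneg C)
    _ = _ := by ring

variable {A H : Type*} [NonUnitalCStarAlgebra A] [PartialOrder A] [StarOrderedRing A]
  [NormedAddCommGroup H] [InnerProductSpace ℂ H] [CompleteSpace H]

theorem MaxTensorProduct.star_tmul {A B : Type*} [NonUnitalCStarAlgebra A]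
    [NonUnitalCStarAlgebra B] (a : A) (b : B) : star (tmul a b) = tmul (star a) (star b) := by
  rw [tmul, tmul, ← map_star, TensorProduct.star_tmul]

/-- Intertwining on `a ⊗ x` reads `φ(a) x N = N x φ(a⋆)⋆`. As `x` commutes with `φ(a⋆)⋆`, the case
`x = 1` turns the right side into `φ(a) N x`; so `xN - Nx` is annihilated by `φ(a)`, which suffices.
-/
theorem VonNeumannAlgebra.exists_similar_of_maxTensorProduct (M : VonNeumannAlgebra H)
    (φ : A →ₙₐ[ℂ] M) (hφ : ∃ C : ℝ, ∀ a : A, ‖φ a‖ ≤ C * ‖a‖)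
    (Φ : MaxTensorProduct A M.commutant →ₙₐ[ℂ] (H →L[ℂ] H))
    (hΦ : IsCompletelyBounded (Φ : MaxTensorProduct A M.commutant →ₗ[ℂ] (H →L[ℂ] H)))
    (h : ∀ (a : A) (x : M.commutant),
      Φ (MaxTensorProduct.tmul a x) = (φ a : H →L[ℂ] H) * (x : H →L[ℂ] H)) :
    ∃ (S : (↥M)ˣ) (π : A →⋆ₙₐ[ℂ] M), ∀ a, π a = (S : M) * φ a * ((S⁻¹ : (↥M)ˣ) : M) := by
  let := CStarAlgebra.spectralOrder (Unitization ℂ (MaxTensorProduct A M.commutant))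
  have := CStarAlgebra.spectralOrderedRing (Unitization ℂ (MaxTensorProduct A M.commutant))
  obtain ⟨C, hC0, hC⟩ := exists_norm_unitization_lift_map_le Φ hΦ
  obtain ⟨N, hN0, hN, hNk⟩ := exists_operator_of_completelyBounded (Unitization.lift Φ) C hC0 hC
  obtain ⟨E, l, hl, -, hE, hE', hEE, hlim⟩ := M.exists_support_idempotent φ hφ
  have hΦN (a : A) (x : M.commutant) : (φ a : H →L[ℂ] H) * x * N =
      N * (x * star (φ (star a) : H →L[ℂ] H)) := by
    have h1 := hN (MaxTensorProduct.tmul a x : MaxTensorProduct A M.commutant)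
    rw [← Unitization.inr_star, MaxTensorProduct.star_tmul] at h1
    simp only [Unitization.lift_apply, NonUnitalAlgHom.toAlgHom_apply, Unitization.fst_inr,
      Unitization.snd_inr, map_zero, zero_add, h, star_mul] at h1
    simpa using h1
  have hφN (a : A) : (φ a : H →L[ℂ] H) * N = N * star (φ (star a) : H →L[ℂ] H) := by
    simpa using hΦN a 1
  refine M.exists_similar_of_operator φ E hE hE' hEE l hlim N hN0
    (((C ^ 2 + 1) * (‖star (E : H →L[ℂ] H)‖ ^ 2 + 1))⁻¹) (by positivity) (fun k => ?_) hφN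
    fun a x hx => ?_
  · rw [inv_mul_le_iff₀ (by positivity)]
    have hNk' : 0 ≤ RCLike.re ⟪k, N k⟫_ℂ :=
      ((ContinuousLinearMap.nonneg_iff_isPositive N).mp hN0).re_inner_nonneg_right k
    calc ‖star (E : H →L[ℂ] H) k‖ ^ 2 ≤ (‖star (E : H →L[ℂ] H)‖ * ‖k‖) ^ 2 := by
          gcongr; exact ContinuousLinearMap.le_opNorm _ _
      _ = ‖star (E : H →L[ℂ] H)‖ ^ 2 * ‖k‖ ^ 2 := mul_pow _ _ _
      _ ≤ (‖star (E : H →L[ℂ] H)‖ ^ 2 + 1) * ((C ^ 2 + 1) * RCLike.re ⟪k, N k⟫_ℂ) := by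
          gcongr
          · exact le_add_of_nonneg_right zero_le_one
          · exact hNk k
      _ = _ := by ring
  · have h1 := M.commute_of_mem (star_mem (φ (star a)).2) hx
    rw [mul_sub, ← mul_assoc, hΦN a ⟨x, hx⟩, ← mul_assoc (φ a : H →L[ℂ] H), hφN, sub_eq_zero,
      h1, mul_assoc]

end CompletelyBounded

/-! ### Universal property of the maximal tensor product -/

namespace MaxTensorProduct

variable {A B E : Type*} [NonUnitalCStarAlgebra A] [NonUnitalCStarAlgebra B]
  [NonUnitalCStarAlgebra E]

/-- The universal property of the maximal tensor product. -/
theorem exists_lift (f : A →⋆ₙₐ[ℂ] E) (g : B →⋆ₙₐ[ℂ] E) (hfg : ∀ a b, Commute (f a) (g b)) :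
    ∃ σ : MaxTensorProduct A B →⋆ₙₐ[ℂ] E, ∀ a b, σ (tmul a b) = f a * g b := by
  let σ₀ : A ⊗[ℂ] B →ₗ[ℂ] E :=
    TensorProduct.lift ((LinearMap.mul ℂ E).compl₁₂ (f : A →ₗ[ℂ] E) (g : B →ₗ[ℂ] E))
  have htmul (a b) : σ₀ (a ⊗ₜ b) = f a * g b := rfl
  have hmul (x y) : σ₀ (x * y) = σ₀ x * σ₀ y := by
    induction x using TensorProduct.induction_on with
    | zero => simp
    | add x x' hx hx' => simp only [add_mul, map_add, hx, hx']
    | tmul a b =>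
      induction y using TensorProduct.induction_on with
      | zero => simp
      | add y y' hy hy' => simp only [mul_add, map_add, hy, hy']
      | tmul a' b' =>
        rw [Algebra.TensorProduct.tmul_mul_tmul, htmul, htmul, htmul, map_mul, map_mul]
        exact (hfg a' b).mul_mul_mul_comm _ _
  have hstar (x) : σ₀ (star x) = star (σ₀ x) := by
    induction x using TensorProduct.induction_on with
    | zero => simp
    | add x x' hx hx' => simp only [star_add, map_add, hx, hx']
    | tmul a b =>
      rw [TensorProduct.star_tmul, htmul, htmul, map_star, map_star, star_mul,
        ← map_star f, ← map_star g]
      exact hfg _ _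
  -- Pulling back the norm of `E` gives a C⋆-seminorm, so `σ₀` is contractive for the maximal one
  -- and extends to the completion.
  let p : CStarSeminorm (A ⊗[ℂ] B) :=
    { toFun := fun x => ‖σ₀ x‖
      map_zero' := by simp
      add_le' := fun x y => by rw [map_add]; exact norm_add_le _ _
      neg' := fun x => by rw [map_neg, norm_neg]
      smul' := fun c x => by rw [map_smul, norm_smul]
      mul_le' := fun x y => by rw [hmul]; exact norm_mul_le _ _
      star_mul_self' := fun x => by rw [hmul, hstar]; exact CStarRing.norm_star_mul_self }
  let q := CStarSeminorm.maxTensor A B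
  let σ₁ : q.Pre →L[ℂ] E := LinearMap.mkContinuous (σ₀ : q.Pre →ₗ[ℂ] E) 1 fun x => by
    rw [one_mul]; exact CStarSeminorm.le_iSup p x
  let σ : q.Compl →L[ℂ] E := ContinuousLinearMap.fromCompletion σ₁
  have hσ (x) : σ (q.incl x) = σ₀ x := ContinuousLinearMap.fromCompletion_apply_coe σ₁ (q.toPre x)
  have hσmul (x y : q.Compl) : σ (x * y) = σ x * σ y := by
    refine q.compl_ind (isClosed_eq (by fun_prop) (by fun_prop)) (fun x => ?_) x
    refine q.compl_ind (isClosed_eq (by fun_prop) (by fun_prop)) (fun y => ?_) y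
    rw [← CStarSeminorm.incl_mul, hσ, hσ, hσ, hmul]
  have hσstar (x : q.Compl) : σ (star x) = star (σ x) := by
    refine q.compl_ind (isClosed_eq (by fun_prop) (by fun_prop)) (fun x => ?_) x
    rw [CStarSeminorm.star_incl, hσ, hσ, hstar]
  exact ⟨
    { toFun := σ
      map_smul' := map_smul σ
      map_zero' := map_zero σ
      map_add' := map_add σ
      map_mul' := hσmul
      map_star' := hσstar }, fun a b => hσ (a ⊗ₜ b)⟩

end MaxTensorProduct

/-! ### From a similarity to a completely bounded extension -/

section Similarity

variable {A D : Type*} [NonUnitalCStarAlgebra A] [PartialOrder A] [StarOrderedRing A]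
  [CStarAlgebra D] [PartialOrder D] [StarOrderedRing D]

theorem CStarMatrix.norm_diagonal_const_le {n : Type*} [Fintype n] [DecidableEq n] (d : D) :
    ‖(CStarMatrix.ofMatrix (Matrix.diagonal fun _ => d) : CStarMatrix n n D)‖ ≤ ‖d‖ := by
  let f : D →⋆ₙₐ[ℂ] CStarMatrix n n D :=
    { toFun := fun d => CStarMatrix.ofMatrix (Matrix.diagonal fun _ => d)
      map_smul' := fun c x => by ext i j; by_cases h : i = j <;> simp [h]
      map_zero' := by ext i j; simp
      map_add' := fun x y => by ext i j; by_cases h : i = j <;> simp [h]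
      map_mul' := fun x y => by
        ext i j
        by_cases h : i = j <;> simp [CStarMatrix.mul_apply, Matrix.diagonal_apply, h]
      map_star' := fun x => by
        ext i j
        by_cases h : i = j <;> simp [CStarMatrix.star_apply, h, eq_comm] }
  exact NonUnitalStarAlgHom.norm_apply_le f d

/-- A homomorphism similar to a ⋆-homomorphism is completely bounded. -/
theorem exists_isCompletelyBounded_of_similar (σ : A →⋆ₙₐ[ℂ] D) (S : Dˣ) :
    ∃ Φ : A →ₙₐ[ℂ] D, IsCompletelyBounded (Φ : A →ₗ[ℂ] D) ∧
      ∀ a, Φ a = ((S⁻¹ : Dˣ) : D) * σ a * S := by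
  let Φ : A →ₙₐ[ℂ] D :=
    { toFun := fun a => ((S⁻¹ : Dˣ) : D) * σ a * S
      map_smul' := fun c a => by simp
      map_zero' := by simp
      map_add' := fun a b => by simp [mul_add, add_mul]
      map_mul' := fun a b => by simp [mul_assoc] }
  refine ⟨Φ, ⟨‖((S⁻¹ : Dˣ) : D)‖ * ‖(S : D)‖, fun n X => ?_⟩, fun a => rfl⟩
  have h1 : X.map (Φ : A →ₗ[ℂ] D) =
      CStarMatrix.ofMatrix (Matrix.diagonal fun _ => ((S⁻¹ : Dˣ) : D)) * CStarMatrix.mapₙₐ σ X *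
        CStarMatrix.ofMatrix (Matrix.diagonal fun _ => (S : D)) := by
    ext i j
    simp [CStarMatrix.mul_apply, Matrix.diagonal_apply, Φ]
  rw [h1]
  calc _ ≤ ‖((S⁻¹ : Dˣ) : D)‖ * ‖X‖ * ‖(S : D)‖ := by
        refine (norm_mul_le _ _).trans ?_
        gcongr
        · refine (norm_mul_le _ _).trans ?_
          gcongr
          · exact CStarMatrix.norm_diagonal_const_le _
          · exact NonUnitalStarAlgHom.norm_apply_le (CStarMatrix.mapₙₐ σ) X
        · exact CStarMatrix.norm_diagonal_const_le _
    _ = _ := by ring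

end Similarity

/-- `π` and the inclusion of `M'` have commuting ranges, so they lift to a ⋆-representation of the
tensor product. Conjugating it by `S` leaves the factor from `M'` unchanged, because `S ∈ M`. -/
theorem VonNeumannAlgebra.exists_maxTensorProduct_of_similar {A H : Type*}
    [NonUnitalCStarAlgebra A] [NormedAddCommGroup H] [InnerProductSpace ℂ H] [CompleteSpace H]
    (M : VonNeumannAlgebra H) (φ : A →ₙₐ[ℂ] M) (S : (↥M)ˣ) (π : A →⋆ₙₐ[ℂ] M)
    (h : ∀ a, π a = (S : M) * φ a * ((S⁻¹ : (↥M)ˣ) : M)) :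
    ∃ Φ : MaxTensorProduct A M.commutant →ₙₐ[ℂ] (H →L[ℂ] H),
      IsCompletelyBounded (Φ : MaxTensorProduct A M.commutant →ₗ[ℂ] (H →L[ℂ] H)) ∧
      ∀ (a : A) (x : M.commutant),
        Φ (MaxTensorProduct.tmul a x) = (φ a : H →L[ℂ] H) * (x : H →L[ℂ] H) := by
  let ι (N : VonNeumannAlgebra H) : N →⋆ₐ[ℂ] (H →L[ℂ] H) := N.toStarSubalgebra.subtype
  obtain ⟨σ, hσ⟩ := MaxTensorProduct.exists_lift ((ι M : M →⋆ₙₐ[ℂ] (H →L[ℂ] H)).comp π)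
    (ι M.commutant : M.commutant →⋆ₙₐ[ℂ] (H →L[ℂ] H))
    fun a x => (M.commute_of_mem (π a).2 x.2).symm
  obtain ⟨Φ, hΦ, hΦS⟩ := exists_isCompletelyBounded_of_similar σ (Units.map (ι M : M →* _) S)
  refine ⟨Φ, hΦ, fun a x => ?_⟩
  rw [hΦS, hσ]
  change ((S⁻¹ : (↥M)ˣ) : M) * ((π a : H →L[ℂ] H) * x) * (S : M) = (φ a : H →L[ℂ] H) * x
  rw [mul_assoc, mul_assoc, M.commute_of_mem (S : M).2 x.2, h, ← mul_assoc, ← mul_assoc]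
  have h1 : ((S⁻¹ : (↥M)ˣ) : M) * ((S : M) * φ a * ((S⁻¹ : (↥M)ˣ) : M)) * (S : M) = φ a := by
    simp [← mul_assoc]
  exact congrArg (fun y : M => (y : H →L[ℂ] H) * x) h1

/-! ### Algebraic implications and the equivalence -/

/-- The off-diagonal corner of a completely positive `2 × 2` matrix of maps is a combination of
four completely positive maps, by polarization. -/
theorem CompletelyPositiveMap.exists_polarization {A B : Type*} [NonUnitalCStarAlgebra A]
    [PartialOrder A] [StarOrderedRing A] [CStarAlgebra B] [PartialOrder B] [StarOrderedRing B]
    (Ψ : A →CP CStarMatrix (Fin 2) (Fin 2) B) :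
    ∃ φ₁ φ₂ φ₃ φ₄ : A →CP B,
      ∀ a : A, Ψ a 1 0 = φ₁ a - φ₂ a + Complex.I • (φ₃ a - φ₄ a) := by
  -- For the vector `(1, ω)/2` the entry `Ψ₁₀` has coefficient `ω̄/4` and `Ψ₀₁` has `ω/4`; with `ω =
  -- 1, -1, i, -i` the combination retains only `Ψ₁₀`.
  obtain ⟨φ₁, h₁⟩ := Ψ.exists_compress ![1 / 2, 1 / 2]
  obtain ⟨φ₂, h₂⟩ := Ψ.exists_compress ![1 / 2, -1 / 2]
  obtain ⟨φ₃, h₃⟩ := Ψ.exists_compress ![1 / 2, Complex.I / 2]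
  obtain ⟨φ₄, h₄⟩ := Ψ.exists_compress ![1 / 2, -Complex.I / 2]
  refine ⟨φ₁, φ₂, φ₃, φ₄, fun a => ?_⟩
  simp only [h₁, h₂, h₃, h₄, Fin.sum_univ_two, Matrix.cons_val_zero, Matrix.cons_val_one,
    RCLike.star_def, map_div₀, map_neg, map_one, map_ofNat, Complex.conj_I]
  match_scalars <;> ring_nf <;> simp; norm_num

/-- A combination `∑ i, Tᵢ⋆ ψᵢ(a) Sᵢ` of completely positive maps is the corner of a completely
positive `2 × 2` matrix of maps. -/
theorem CompletelyPositiveMap.exists_matrix_of_sum {A B : Type*} [NonUnitalCStarAlgebra A]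
    [PartialOrder A] [StarOrderedRing A] [CStarAlgebra B] [PartialOrder B] [StarOrderedRing B]
    (φ : A → B) (n : ℕ) (ψ : Fin n → (A →CP B)) (T S : Fin n → B)
    (h : ∀ a, φ a = ∑ i, star (T i) * ψ i a * S i) :
    ∃ (φ₁ φ₂ : A →CP B) (Ψ : A →CP CStarMatrix (Fin 2) (Fin 2) B),
      ∀ a : A, Ψ a = CStarMatrix.ofMatrix !![φ₁ a, star (φ (star a)); φ a, φ₂ a] := by
  obtain ⟨Ψ, hΨ⟩ := exists_rowConjSum ψ S T
  refine ⟨conjSum ψ S, conjSum ψ T, Ψ, fun a => ?_⟩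
  rw [hΨ, conjSum_apply, conjSum_apply, h, h, star_sum]
  simp only [star_mul, star_star, CompletelyPositiveMap.map_star', mul_assoc]

theorem mainTheorem6 {A : Type*} [NonUnitalCStarAlgebra A] [PartialOrder A] [StarOrderedRing A]
    {H : Type*} [NormedAddCommGroup H] [InnerProductSpace ℂ H] [CompleteSpace H]
    (M : VonNeumannAlgebra H) (φ : A →ₙₐ[ℂ] M) (hφ : ∃ C : ℝ, ∀ a : A, ‖φ a‖ ≤ C * ‖a‖) :
    List.TFAE [
      -- (1) `φ` is similar in `M` to a ⋆-representation
      ∃ (S : (↥M)ˣ) (π : A →⋆ₙₐ[ℂ] M), ∀ a : A, π a = (S : M) * φ a * ((S⁻¹ : (↥M)ˣ) : M),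
      -- (2) `a ⊗ x ↦ φ(a) x` is a completely bounded representation of `A ⊗_max M'` on `H`
      ∃ Φ : MaxTensorProduct A M.commutant →ₙₐ[ℂ] (H →L[ℂ] H),
        IsCompletelyBounded (Φ : MaxTensorProduct A M.commutant →ₗ[ℂ] (H →L[ℂ] H)) ∧
        ∀ (a : A) (x : M.commutant),
          Φ (MaxTensorProduct.tmul a x) = (φ a : H →L[ℂ] H) * (x : H →L[ℂ] H),
      -- (3) `φ` is a combination of four completely positive maps
      ∃ φ₁ φ₂ φ₃ φ₄ : A →CP M,
        ∀ a : A, φ a = φ₁ a - φ₂ a + Complex.I • (φ₃ a - φ₄ a),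
      -- (4) `φ` has a `2 × 2` completely positive dilation
      ∃ (φ₁ φ₂ : A →CP M) (Ψ : A →CP CStarMatrix (Fin 2) (Fin 2) M),
        ∀ a : A, Ψ a = CStarMatrix.ofMatrix
          !![φ₁ a, star (φ (star a)); φ a, φ₂ a],
      -- (5)
      ∃ (ψ : A →CP M) (T S : M), ∀ a : A, φ a = star T * ψ a * S,
      -- (6)
      ∃ (n : ℕ) (ψ : Fin n → (A →CP M)) (T S : Fin n → M),
        ∀ a : A, φ a = ∑ i, star (T i) * ψ i a * S i,
      -- (7)
      ∃ (n : ℕ) (π : Fin n → (A →⋆ₙₐ[ℂ] M)) (T : Fin n → (↥M)ˣ) (α : Fin n → ℝ),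
        (∀ i, 0 ≤ (T i : M)) ∧ (∀ i, 0 < α i) ∧ ∑ i, α i = 1 ∧
        ∀ a : A, φ a = ∑ i, ((α i : ℝ) : ℂ) • ((T i : M) * π i a * (((T i)⁻¹ : (↥M)ˣ) : M))] := by
  tfae_have 1 → 2 := fun ⟨S, π, h⟩ => M.exists_maxTensorProduct_of_similar φ S π h
  tfae_have 2 → 1 := fun ⟨Φ, hΦ, h⟩ => M.exists_similar_of_maxTensorProduct φ hφ Φ hΦ h
  tfae_have 1 → 5 := fun ⟨S, π, h⟩ =>
    ⟨(π : A →CP M), star ((S⁻¹ : (↥M)ˣ) : M), S, fun a => by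
      rw [star_star]
      change φ a = _ * π a * _
      rw [h]
      simp [← mul_assoc]⟩
  tfae_have 5 → 6 := fun ⟨ψ, T, S, h⟩ =>
    ⟨1, fun _ => ψ, fun _ => T, fun _ => S, fun a => by rw [h, Fin.sum_univ_one]⟩
  tfae_have 6 → 4 := fun ⟨n, ψ, T, S, h⟩ =>
    CompletelyPositiveMap.exists_matrix_of_sum φ n ψ T S h
  tfae_have 4 → 3 := by
    rintro ⟨φ₁, φ₂, Ψ, hΨ⟩
    obtain ⟨ψ₁, ψ₂, ψ₃, ψ₄, h⟩ := Ψ.exists_polarization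
    exact ⟨ψ₁, ψ₂, ψ₃, ψ₄, fun a => by rw [← h, hΨ]; rfl⟩
  -- The `Tᵢ` enter through their adjoints, hence the conjugated coefficients `-i` and `i`.
  tfae_have 3 → 6 := fun ⟨φ₁, φ₂, φ₃, φ₄, h⟩ =>
    ⟨4, ![φ₁, φ₂, φ₃, φ₄], ![1, -1, -Complex.I • 1, Complex.I • 1], fun _ => 1, fun a => by
      rw [h]
      simp [Fin.sum_univ_four, sub_eq_add_neg, add_assoc]⟩
  tfae_have 4 → 1 := fun ⟨φ₁, φ₂, Ψ, hΨ⟩ => M.exists_similar_of_matrix φ hφ φ₁ φ₂ Ψ hΨ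
  tfae_have 1 → 7 := by
    rintro ⟨S, π, h⟩
    obtain ⟨T, ρ, hT, hρ⟩ := exists_similar_nonneg φ S π h
    exact ⟨1, fun _ => ρ, fun _ => T, fun _ => 1, fun _ => hT, fun _ => one_pos, by simp,
      fun a => by simp [hρ]⟩
  tfae_have 7 → 6 := fun ⟨n, π, T, α, _, _, _, h⟩ =>
    ⟨n, fun i => (π i : A →CP M), fun i => ((α i : ℝ) : ℂ) • star (T i : M),
      fun i => (((T i)⁻¹ : (↥M)ˣ) : M), fun a => by
        rw [h]
        refine Finset.sum_congr rfl fun i _ => ?_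
        change _ = _ * π i a * _
        simp⟩
  tfae_finish
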